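/- Let $p$ be a prime, $r\ge 1$, and $\mathbb{Z}_{p^r}$ the ring of integers modulo $p^r$. For $a\in\mathbb{Z}_{p^r}$ and $0\le s\le r$ let $[a]_s\in\{0,\dots,p^s-1\}$ be the representative of the coset $a+p^s\mathbb{Z}_{p^r}$. For a probability mass function $P$ on a finite set $\mathcal{A}$ and $\epsilon>0$, a sequence $\mathbf{x}\in\mathcal{A}^n$ is $\epsilon$-typical if $\big|\tfrac1n N(a|\mathbf{x})-P(a)\big|\le \epsilon/|\mathcal{A}|$ for all $a\in\mathcal{A}$, where $N(a|\mathbf{x})$ is the number of occurrences of $a$ in $\mathbf{x}$, and no $a$ with $P(a)=0$ occurs in $\mathbf{x}$; $A_\epsilon^{(n)}$ denotes the set of such sequences. Entropies are in bits. Let $\mathcal{Q}$ and $\mathcal{X}$ be finite sets, let $(U,Q)$ be a pair of random variables on $\mathbb{Z}_{p^r}\times\mathcal{Q}$ with $P_Q(q)>0$ for all $q\in\mathcal{Q}$ and $H([U]_s|Q)>0$ for $1\le s\le r$, let $(X,\hat X)\sim P_{X\hat X}$ take values in $\mathcal{X}\times\mathbb{Z}_{p^r}$, and let $c>0$. There is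 a function $\eta$ with $\eta(\epsilon)\to0$ as $\epsilon\downarrow0$ such that for all $\epsilon>0$ and $\delta>0$ there is an $N$ such that the following holds for every $n>N$. Let $k_q$, $q\in\mathcal{Q}$, be nonnegative integers with $|k_q-P_Q(q)\,cn|<1$ (so that $k_q=P_Q(q)\,cn$ up to rounding), put $k=\sum_q k_q$, and let $\mathcal{U}_n=\prod_{q\in\mathcal{Q}}A_\epsilon^{(k_q)}(U_q)\subseteq\mathbb{Z}_{p^r}^{k}$, where $U_q$ has the law of $U$ given $Q=q$. Let $\mathcal{C}_n=\{\mathbf{u}\mathbf{G}+\mathbf{b}:\mathbf{u}\in\mathcal{U}_n\}$ be the random $(n,k)$ quasi group code in which the entries of the $k\times n$ matrix $\mathbf{G}$ and of $\mathbf{b}\in\mathbb{Z}_{p^r}^n$ are independent and uniform on $\mathbb{Z}_{p^r}$, and let $\mathbf{X}^n$, independent of $(\mathbf{G},\mathbf{b})$, have law $\prod_{i=1}^nP_X$. If $$R_n>\max_{1\le s\le r}\frac{H(U|Q)}{H([U]_s|Q)}\Big(\log_2p^s-H([\hat X]_s|X)+\eta(\epsilon)\Big),$$ then $$P\big\{\exists\,\hat{\mathbf{x}}\in\mathcal{C}_n:(\mathbf{X}^n,\hat{\mathbf{x}})\in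 A_\epsilon^{(n)}(X,\hat X)\big\}>1-\delta .$$ Here $R_n$ may be taken to be either $\frac1n\log_2|\mathcal{U}_n|$ or the rate $\frac1n\log_2|\mathcal{C}_n|$ of any one realization of the random code $\mathcal{C}_n$. -/

import Mathlib

/-! Probability mass functions on a finite type `α` are vectors `P : α → ℝ` in `stdSimplex ℝ α`. -/

namespace QGC

noncomputable section

/-- The law of the random variable `f` when the underlying outcome has probability mass
function `P`. -/
def law {Ω α : Type*} [Fintype Ω] [DecidableEq α] (P : Ω → ℝ) (f : Ω → α) (a : α) : ℝ :=
  ∑ ω with f ω = a, P ω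

/-- The conditional entropy `H(V | W)` in bits, for random variables `V`, `W` on a finite
probability space with probability mass function `P`. Pairs of probability zero contribute zero. -/
def condEntropy {Ω α β : Type*} [Fintype Ω] [Fintype α] [DecidableEq α] [Fintype β]
    [DecidableEq β] (P : Ω → ℝ) (V : Ω → α) (W : Ω → β) : ℝ :=
  -∑ a, ∑ b, law P (fun ω => (V ω, W ω)) (a, b) *
    Real.logb 2 (law P (fun ω => (V ω, W ω)) (a, b) / law P W b)

/-- `[a]_s`: the representative in `{0, …, p ^ s - 1}` of the coset of `a` modulo the subgroup
`p ^ s ℤ_{p ^ r}`. -/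
def cosetRep (p r s : ℕ) (a : ZMod (p ^ r)) : ZMod (p ^ r) :=
  ((a.val % p ^ s : ℕ) : ZMod (p ^ r))

/-- The number of occurrences of the letter `a` in the sequence `x`. -/
def occurrences {α : Type*} [DecidableEq α] {n : ℕ} (a : α) (x : Fin n → α) : ℕ :=
  (Finset.univ.filter fun i => x i = a).card

/-- `ε`-typicality of a sequence with respect to the probability mass function `P`. -/
def IsTypical {α : Type*} [Fintype α] [DecidableEq α] (P : α → ℝ) (ε : ℝ) {n : ℕ}
    (x : Fin n → α) : Prop :=
  (∀ a, |(occurrences a x : ℝ) / n - P a| ≤ ε / Fintype.card α) ∧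
    ∀ a, P a = 0 → ∀ i, x i ≠ a

/-- Joint `ε`-typicality of a pair of sequences. -/
def JointlyTypical {α β : Type*} [Fintype α] [DecidableEq α] [Fintype β] [DecidableEq β]
    (P : α × β → ℝ) (ε : ℝ) {n : ℕ} (x : Fin n → α) (y : Fin n → β) : Prop :=
  IsTypical P ε fun i => (x i, y i)

/-- The conditional probability mass function of the first coordinate given that the second
coordinate equals `q`. -/
def condLaw {α Q : Type*} [Fintype α] [Fintype Q] [DecidableEq Q] (P : α × Q → ℝ) (q : Q)
    (a : α) : ℝ :=
  P (a, q) / law P Prod.snd q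

/-- The index set: the Cartesian product over `q` of the `ε`-typical sets of length `k q` of the
conditional laws of `U` given `Q = q`. An element is a vector with `∑ q, k q` coordinates,
arranged in blocks labelled by `q`. -/
def indexSet {m : ℕ} [NeZero m] {Q : Type*} [Fintype Q] [DecidableEq Q] (P : ZMod m × Q → ℝ)
    (ε : ℝ) (k : Q → ℕ) : Set ((Σ q, Fin (k q)) → ZMod m) :=
  {u | ∀ q, IsTypical (condLaw P q) ε fun j => u ⟨q, j⟩}

/-- The quasi group code `{u G + b : u ∈ 𝒰}`, where `𝒰` is the index set. -/
def code {m : ℕ} [NeZero m] {Q : Type*} [Fintype Q] [DecidableEq Q] (P : ZMod m × Q → ℝ)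
    (ε : ℝ) (k : Q → ℕ) {n : ℕ} (G : Matrix (Σ q, Fin (k q)) (Fin n) (ZMod m))
    (b : Fin n → ZMod m) : Set (Fin n → ZMod m) :=
  {y | ∃ u ∈ indexSet P ε k, y = Matrix.vecMul u G + b}

/-- `(1 / n) log₂ |S|`, the rate of a set `S` at block length `n`. -/
def rate {α : Type*} (n : ℕ) (S : Set α) : ℝ :=
  Real.logb 2 (S.ncard : ℝ) / n

/-- The probability mass function of `(𝐗, G, b)`, where `𝐗` is i.i.d. with law `PX`, the matrix
`G` and the translation `b` have uniform entries, and everything is independent. -/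
def ensembleLaw {m : ℕ} [NeZero m] {Q X : Type*} [Fintype Q] [DecidableEq Q] (PX : X → ℝ)
    (k : Q → ℕ) (n : ℕ)
    (ω : (Fin n → X) × Matrix (Σ q, Fin (k q)) (Fin n) (ZMod m) × (Fin n → ZMod m)) : ℝ :=
  (∏ i, PX (ω.1 i)) *
    (1 / (Fintype.card (Matrix (Σ q, Fin (k q)) (Fin n) (ZMod m)) : ℝ)) *
    (1 / (Fintype.card (Fin n → ZMod m) : ℝ))

/-- The probability that the random code contains a codeword that is jointly `ε`-typical with
the random source sequence `𝐗`. -/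
def coverProb {m : ℕ} [NeZero m] {Q X : Type*} [Fintype Q] [DecidableEq Q] [Fintype X]
    [DecidableEq X] (PUQ : ZMod m × Q → ℝ) (PXX : X × ZMod m → ℝ) (ε : ℝ) (k : Q → ℕ)
    (n : ℕ) : ℝ :=
  ∑ ω : (Fin n → X) × Matrix (Σ q, Fin (k q)) (Fin n) (ZMod m) × (Fin n → ZMod m),
    Set.indicator {ω | ∃ y ∈ code PUQ ε k ω.2.1 ω.2.2, JointlyTypical PXX ε ω.1 y}
      (ensembleLaw (law PXX Prod.fst) k n) ω

/-- The `s`-th expression of the covering bound,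
`(H(U|Q) / H([U]_s|Q)) * (log₂ p ^ s - H([X̂]_s|X) + e)`. -/
def coveringBound {p r : ℕ} [NeZero (p ^ r)] {Q X : Type*} [Fintype Q] [DecidableEq Q]
    [Fintype X] [DecidableEq X] (PUQ : ZMod (p ^ r) × Q → ℝ) (PXX : X × ZMod (p ^ r) → ℝ)
    (e : ℝ) (s : ℕ) : ℝ :=
  condEntropy PUQ Prod.fst Prod.snd /
      condEntropy PUQ (fun ω => cosetRep p r s ω.1) Prod.snd *
    (Real.logb 2 ((p : ℝ) ^ s) - condEntropy PXX (fun ω => cosetRep p r s ω.2) Prod.fst + e)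

end

end QGC

/-!
By the second moment method, a random code misses the sequences jointly typical with a typical
source sequence only if pairs of codewords are too correlated. The vectors `u G + b` and `u' G + b`
are uniform on the pairs of vectors that agree modulo the ideal `I` generated by the coordinates of
`u - u'`, so the correlation is governed, for each proper ideal `I`, by the collision probabilities
modulo `I` of the index set and of the set of jointly typical sequences. A typical fiber has almost
uniform conditional probabilities, so these collision probabilities are `2` to the minus `n` times a
conditional entropy, up to an error of order `ε n` in the exponent.
-/

namespace QGC

open Finset Filter MeasureTheory ProbabilityTheory
open scoped Matrix Topology

section MassMeasure

variable {α : Type*} [Fintype α] {P : α → ℝ}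

variable [MeasurableSpace α]

/-- The probability measure whose probability mass function is `P`: it makes the results of
Mathlib on variances of independent sums available for sums over sequences. -/
noncomputable def massMeasure (hP : P ∈ stdSimplex ℝ α) : Measure α :=
  (PMF.ofFintype (fun a => ENNReal.ofReal (P a)) <| by
    rw [← ENNReal.ofReal_sum_of_nonneg fun a _ => hP.1 a, hP.2, ENNReal.ofReal_one]).toMeasure

instance (hP : P ∈ stdSimplex ℝ α) : IsProbabilityMeasure (massMeasure hP) :=
  PMF.toMeasure.isProbabilityMeasure _

variable [MeasurableSingletonClass α]

lemma massMeasure_real_singleton (hP : P ∈ stdSimplex ℝ α) (a : α) :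
    (massMeasure hP).real {a} = P a := by
  rw [Measure.real, massMeasure, PMF.toMeasure_apply_singleton _ _ (measurableSet_singleton a),
    PMF.ofFintype_apply, ENNReal.toReal_ofReal (hP.1 a)]

lemma pi_massMeasure_real (hP : P ∈ stdSimplex ℝ α) {n : ℕ} (S : Finset (Fin n → α)) :
    (Measure.pi fun _ : Fin n => massMeasure hP).real S = ∑ x ∈ S, ∏ i, P (x i) := by
  rw [← sum_measureReal_singleton]
  refine sum_congr rfl fun x _ => ?_
  simp only [Measure.real, Measure.pi_singleton, ENNReal.toReal_prod]
  exact prod_congr rfl fun i _ => massMeasure_real_singleton hP (x i)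

end MassMeasure

section LawOfLargeNumbers

variable {α : Type*} [Fintype α] [DecidableEq α] {P : α → ℝ}

lemma sum_prod_le_abs_occurrences_sub (hP : P ∈ stdSimplex ℝ α) (a : α) (n : ℕ) {t : ℝ}
    (ht : 0 < t) :
    ∑ x : Fin n → α with t ≤ |occurrences a x - n * P a|, ∏ i, P (x i) ≤ n / (4 * t ^ 2) := by
  let _ : MeasurableSpace α := ⊤
  let hit : α → ℝ := fun b => if b = a then 1 else 0
  have hit_bounds (b : α) : hit b ∈ Set.Icc 0 1 := by
    by_cases hb : b = a <;> simp [hit, hb]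
  have hit_memLp : MemLp hit 2 (massMeasure hP) :=
    memLp_of_bounded (Eventually.of_forall hit_bounds) (measurable_from_top.aestronglyMeasurable) 2
  have integral_hit : ∫ b, hit b ∂massMeasure hP = P a := by
    rw [integral_fintype (hit_memLp.integrable one_le_two)]
    simp [hit, massMeasure_real_singleton]
  let μ := Measure.pi fun _ : Fin n => massMeasure hP
  have hit_eval_memLp (i : Fin n) : MemLp (fun x : Fin n → α => hit (x i)) 2 μ :=
    hit_memLp.comp_measurePreserving (measurePreserving_eval _ i)
  have hsum_memLp : MemLp (∑ i, fun x : Fin n → α => hit (x i)) 2 μ :=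
    memLp_finsetSum' _ fun i _ => hit_eval_memLp i
  have integral_sum : μ[∑ i, fun x : Fin n → α => hit (x i)] = n * P a := by
    simp only [Finset.sum_apply]
    rw [integral_finsetSum _ fun i _ => (hit_eval_memLp i).integrable one_le_two]
    simp [μ, integral_comp_eval, integral_hit, measurable_from_top.aestronglyMeasurable]
  have variance_sum_le : Var[∑ i, fun x : Fin n → α => hit (x i); μ] ≤ n / 4 := by
    rw [variance_sum_pi fun _ => hit_memLp]
    calc ∑ _i : Fin n, Var[hit; massMeasure hP] ≤ ∑ _i : Fin n, ((1 - 0) / 2) ^ 2 :=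
          sum_le_sum fun _ _ => variance_le_sq_of_bounded (Eventually.of_forall hit_bounds)
            measurable_from_top.aemeasurable
      _ = n / 4 := by simp; ring
  have chebyshev := meas_ge_le_variance_div_sq hsum_memLp ht
  have sum_hit (x : Fin n → α) : ∑ i, hit (x i) = occurrences a x := by
    simp [hit, occurrences]
  rw [integral_sum] at chebyshev
  simp only [Finset.sum_apply, sum_hit] at chebyshev
  calc ∑ x : Fin n → α with t ≤ |occurrences a x - n * P a|, ∏ i, P (x i)
      = μ.real {x | t ≤ |occurrences a x - n * P a|} := by
        rw [← pi_massMeasure_real hP]; simp [μ]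
    _ ≤ Var[∑ i, fun x : Fin n → α => hit (x i); μ] / t ^ 2 :=
        ENNReal.toReal_le_of_le_ofReal (div_nonneg (variance_nonneg _ _) (sq_nonneg t)) chebyshev
    _ ≤ n / 4 / t ^ 2 := by gcongr
    _ = n / (4 * t ^ 2) := div_div _ _ _

open Classical in
/-- The set `A_ε^(n)` of `ε`-typical sequences, as a finset. -/
noncomputable def typicalSet (P : α → ℝ) (ε : ℝ) (n : ℕ) : Finset (Fin n → α) :=
  {x | IsTypical P ε x}

@[simp]
lemma mem_typicalSet {ε : ℝ} {n : ℕ} {x : Fin n → α} :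
    x ∈ typicalSet P ε n ↔ IsTypical P ε x := by
  simp [typicalSet]

lemma exists_le_abs_occurrences_sub {ε : ℝ} {n : ℕ} (hn : 0 < n) {x : Fin n → α}
    (hx : x ∉ typicalSet P ε n) (hpos : ∏ i, P (x i) ≠ 0) :
    ∃ a, n * ε / Fintype.card α ≤ |occurrences a x - n * P a| := by
  have hsupport : ∀ a, P a = 0 → ∀ i, x i ≠ a := fun a ha i hi =>
    hpos (prod_eq_zero (mem_univ i) (hi ▸ ha))
  obtain ⟨a, ha⟩ : ∃ a, ε / Fintype.card α < |(occurrences a x : ℝ) / n - P a| := by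
    by_contra! h
    exact hx (mem_typicalSet.2 ⟨h, hsupport⟩)
  have hn' : (0 : ℝ) < n := by exact_mod_cast hn
  refine ⟨a, ?_⟩
  calc n * ε / Fintype.card α = n * (ε / Fintype.card α) := mul_div_assoc _ _ _
    _ ≤ n * |(occurrences a x : ℝ) / n - P a| := by gcongr
    _ = |occurrences a x - n * P a| := by
      rw [← abs_of_pos hn', ← abs_mul, abs_of_pos hn', mul_sub, mul_div_cancel₀ _ hn'.ne']

lemma sum_le_sum_sum_filter {ι κ : Type*} [Fintype ι] [Fintype κ] {f : ι → ℝ} (hf : ∀ x, 0 ≤ f x)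
    {S : Finset ι} {p : κ → ι → Prop} [∀ a, DecidablePred (p a)]
    (hp : ∀ x ∈ S, f x ≠ 0 → ∃ a, p a x) : ∑ x ∈ S, f x ≤ ∑ a, ∑ x with p a x, f x := by
  have hterm (x a) : 0 ≤ if p a x then f x else 0 := ite_nonneg (hf x) le_rfl
  calc ∑ x ∈ S, f x ≤ ∑ x ∈ S, ∑ a, if p a x then f x else 0 := by
        refine sum_le_sum fun x hx => ?_
        rcases eq_or_ne (f x) 0 with hfx | hfx
        · exact hfx.le.trans (sum_nonneg fun a _ => hterm x a)
        · obtain ⟨a, ha⟩ := hp x hx hfx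
          exact (if_pos ha).ge.trans (single_le_sum (fun a _ => hterm x a) (mem_univ a))
    _ ≤ ∑ x, ∑ a, if p a x then f x else 0 :=
        sum_le_univ_sum_of_nonneg fun x => sum_nonneg fun a _ => hterm x a
    _ = ∑ a, ∑ x with p a x, f x := by simp only [sum_filter, sum_comm (s := univ (α := ι))]

lemma sum_prod_compl_typicalSet_le (hP : P ∈ stdSimplex ℝ α) {ε : ℝ} (hε : 0 < ε) {n : ℕ}
    (hn : 0 < n) :
    ∑ x ∈ (typicalSet P ε n)ᶜ, ∏ i, P (x i) ≤
      Fintype.card α ^ 3 / (4 * ε ^ 2) * (n : ℝ)⁻¹ := by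
  have : (0 : ℝ) < n := by exact_mod_cast hn
  obtain ⟨a₀⟩ : Nonempty α := by
    by_contra h
    have := not_nonempty_iff.1 h
    simpa using hP.2
  have hα : (0 : ℝ) < Fintype.card α := by exact_mod_cast Fintype.card_pos_iff.2 ⟨a₀⟩
  calc ∑ x ∈ (typicalSet P ε n)ᶜ, ∏ i, P (x i)
      ≤ ∑ a, ∑ x : Fin n → α with n * ε / Fintype.card α ≤ |occurrences a x - n * P a|,
          ∏ i, P (x i) :=
        sum_le_sum_sum_filter (fun x => prod_nonneg fun i _ => hP.1 _) fun x hx hpos =>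
          exists_le_abs_occurrences_sub hn (mem_compl.1 hx) hpos
    _ ≤ ∑ _a : α, n / (4 * (n * ε / Fintype.card α) ^ 2) :=
        sum_le_sum fun a _ => sum_prod_le_abs_occurrences_sub hP a n (by positivity)
    _ = Fintype.card α ^ 3 / (4 * ε ^ 2) * (n : ℝ)⁻¹ := by
        rw [sum_const, card_univ, nsmul_eq_mul]
        field_simp

lemma eventually_sum_prod_compl_typicalSet_lt (hP : P ∈ stdSimplex ℝ α) {ε : ℝ} (hε : 0 < ε)
    {δ : ℝ} (hδ : 0 < δ) :
    ∀ᶠ n in atTop, ∑ x ∈ (typicalSet P ε n)ᶜ, ∏ i, P (x i) < δ := by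
  have hlim : Tendsto (fun n : ℕ => Fintype.card α ^ 3 / (4 * ε ^ 2) * (n : ℝ)⁻¹) atTop (𝓝 0) := by
    simpa only [mul_zero] using
      (tendsto_inv_atTop_nhds_zero_nat (𝕜 := ℝ)).const_mul (Fintype.card α ^ 3 / (4 * ε ^ 2))
  filter_upwards [hlim.eventually_lt_const hδ, eventually_gt_atTop 0] with n hn hpos
  exact (sum_prod_compl_typicalSet_le hP hε hpos).trans_lt hn

end LawOfLargeNumbers

section Entropy

variable {Ω α β : Type*} [Fintype Ω] [DecidableEq β] {P : Ω → ℝ}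

lemma le_law (hP : ∀ ω, 0 ≤ P ω) (W : Ω → β) (ω : Ω) : P ω ≤ law P W (W ω) :=
  single_le_sum (fun ω _ => hP ω) (mem_filter.2 ⟨mem_univ ω, rfl⟩)

lemma law_pair_le [DecidableEq α] (hP : ∀ ω, 0 ≤ P ω) (V : Ω → α) (W : Ω → β) (a : α) (b : β) :
    law P (fun ω => (V ω, W ω)) (a, b) ≤ law P W b :=
  sum_le_sum_of_subset_of_nonneg
    (monotone_filter_right _ fun _ _ h => congrArg Prod.snd h) fun ω _ _ => hP ω

lemma law_mem_stdSimplex [Fintype β] (hP : P ∈ stdSimplex ℝ Ω) (W : Ω → β) :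
    law P W ∈ stdSimplex ℝ β :=
  ⟨fun _ => sum_nonneg fun ω _ => hP.1 ω, (sum_fiberwise univ W P).trans hP.2⟩

lemma law_snd {α : Type*} [Fintype α] [Fintype β] (P : α × β → ℝ) (b : β) :
    law P Prod.snd b = ∑ a, P (a, b) := by
  simp [law, sum_filter, Fintype.sum_prod_type]

/-- The conditional probability of the outcome `ω` given the value of `W` at `ω`. -/
noncomputable def condProb (P : Ω → ℝ) (W : Ω → β) (ω : Ω) : ℝ :=
  P ω / law P W (W ω)

lemma condProb_nonneg (hP : ∀ ω, 0 ≤ P ω) (W : Ω → β) (ω : Ω) : 0 ≤ condProb P W ω :=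
  div_nonneg (hP ω) ((hP ω).trans (le_law hP W ω))

lemma condProb_pos (hP : ∀ ω, 0 ≤ P ω) (W : Ω → β) {ω : Ω} (hω : 0 < P ω) :
    0 < condProb P W ω :=
  div_pos hω (hω.trans_le (le_law hP W ω))

lemma condProb_le_one (hP : ∀ ω, 0 ≤ P ω) (W : Ω → β) (ω : Ω) : condProb P W ω ≤ 1 :=
  div_le_one_of_le₀ (le_law hP W ω) ((hP ω).trans (le_law hP W ω))

lemma condProb_mul_law (hP : ∀ ω, 0 ≤ P ω) (W : Ω → β) (ω : Ω) :
    condProb P W ω * law P W (W ω) = P ω :=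
  div_mul_cancel_of_imp fun h => ((le_law hP W ω).trans_eq h).antisymm (hP ω)

lemma condProb_le_condProb_pair [DecidableEq α] (hP : ∀ ω, 0 ≤ P ω) (V : Ω → α) (W : Ω → β)
    (ω : Ω) : condProb P W ω ≤ condProb P (fun ω => (V ω, W ω)) ω := by
  rcases (hP ω).eq_or_lt with hω | hω
  · simp [condProb, ← hω]
  · exact div_le_div_of_nonneg_left hω.le (hω.trans_le (le_law hP (fun ω => (V ω, W ω)) ω))
      (law_pair_le hP V W _ _)

lemma sum_condProb_fiber_le_one (P : Ω → ℝ) (W : Ω → β) (b : β) :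
    ∑ ω with W ω = b, condProb P W ω ≤ 1 := by
  calc ∑ ω with W ω = b, condProb P W ω = law P W b / law P W b := by
        rw [law, sum_div]
        exact sum_congr rfl fun ω hω => by rw [condProb, (mem_filter.1 hω).2, law]
    _ ≤ 1 := div_self_le_one _

lemma condEntropy_eq_neg_sum [Fintype α] [DecidableEq α] [Fintype β] (P : Ω → ℝ) (V : Ω → α)
    (W : Ω → β) :
    condEntropy P V W = -∑ ω, P ω *
      Real.logb 2 (law P (fun ω => (V ω, W ω)) (V ω, W ω) / law P W (W ω)) := by
  rw [condEntropy, ← Fintype.sum_prod_type', ← sum_fiberwise univ fun ω => (V ω, W ω)]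
  refine congrArg _ (sum_congr rfl fun ab _ => ?_)
  rw [law, sum_mul]
  refine sum_congr rfl fun ω hω => ?_
  rw [(mem_filter.1 hω).2.symm]
  rfl

variable [DecidableEq Ω] [Fintype β]

lemma condEntropy_id (P : Ω → ℝ) (W : Ω → β) :
    condEntropy P id W = -∑ ω, P ω * Real.logb 2 (condProb P W ω) := by
  have law_pair (ω : Ω) : law P (fun ω => (ω, W ω)) (ω, W ω) = P ω := by
    have : ({ω' | (ω', W ω') = (ω, W ω)} : Finset Ω) = {ω} := by ext; aesop
    rw [law, this, sum_singleton]
  simp only [condEntropy_eq_neg_sum, id_eq, law_pair, condProb]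

lemma condEntropy_id_nonneg (hP : ∀ ω, 0 ≤ P ω) (W : Ω → β) : 0 ≤ condEntropy P id W := by
  rw [condEntropy_id, neg_nonneg]
  exact sum_nonpos fun ω _ => mul_nonpos_of_nonneg_of_nonpos (hP ω) <|
    Real.logb_nonpos one_lt_two (condProb_nonneg hP W ω) (condProb_le_one hP W ω)

variable [Fintype α] [DecidableEq α]

lemma condEntropy_id_eq_add (hP : ∀ ω, 0 ≤ P ω) (V : Ω → α) (W : Ω → β) :
    condEntropy P id W = condEntropy P V W + condEntropy P id fun ω => (V ω, W ω) := by
  rw [condEntropy_id, condEntropy_id, condEntropy_eq_neg_sum, ← neg_add, ← sum_add_distrib]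
  refine congrArg _ (sum_congr rfl fun ω _ => ?_)
  rcases (hP ω).eq_or_lt with hω | hω
  · simp [← hω]
  · have hW := hω.trans_le (le_law hP W ω)
    have hVW := hω.trans_le (le_law hP (fun ω => (V ω, W ω)) ω)
    rw [← mul_add, condProb, condProb, ← Real.logb_mul (by positivity) (by positivity)]
    congr 2
    field_simp

lemma condEntropy_le_condEntropy_id (hP : ∀ ω, 0 ≤ P ω) (V : Ω → α) (W : Ω → β) :
    condEntropy P V W ≤ condEntropy P id W := by
  rw [condEntropy_id_eq_add hP V W]
  exact le_add_of_nonneg_right (condEntropy_id_nonneg hP _)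

end Entropy

section CondLaw

variable {α β Q : Type*} [Fintype α] [Fintype Q] [DecidableEq Q] {P : α × Q → ℝ}

lemma condLaw_mem_stdSimplex (hP : ∀ ω, 0 ≤ P ω) {q : Q} (hq : 0 < law P Prod.snd q) :
    condLaw P q ∈ stdSimplex ℝ α := by
  refine ⟨fun a => div_nonneg (hP _) hq.le, ?_⟩
  simp only [condLaw]
  rw [← sum_div, ← law_snd, div_self hq.ne']

lemma law_condLaw [DecidableEq β] (P : α × Q → ℝ) (V : α → β) (b : β) (q : Q) :
    law (condLaw P q) V b = law P (fun ω => (V ω.1, ω.2)) (b, q) / law P Prod.snd q := by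
  simp [law, condLaw, sum_filter, Fintype.sum_prod_type, ite_and, sum_div, ite_div]

lemma condEntropy_eq_sum_condLaw [Fintype β] [DecidableEq β] (hP : ∀ ω, 0 ≤ P ω)
    (hQ : ∀ q, 0 < law P Prod.snd q) (V : α → β) :
    condEntropy P (fun ω => V ω.1) Prod.snd =
      ∑ q, law P Prod.snd q * condEntropy (condLaw P q) V fun _ => () := by
  have law_unit (q : Q) : law (condLaw P q) (fun _ => ()) () = 1 := by
    simpa [law] using (condLaw_mem_stdSimplex hP (hQ q)).2
  simp only [condEntropy, law_unit, div_one, univ_unique, sum_singleton, mul_neg, mul_sum,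
    sum_neg_distrib, PUnit.default_eq_unit]
  rw [sum_comm]
  refine congrArg _ (sum_congr rfl fun q _ => sum_congr rfl fun b _ => ?_)
  have law_pair_unit : law (condLaw P q) (fun a => (V a, ())) (b, ()) = law (condLaw P q) V b := by
    simp [law]
  rw [law_pair_unit, law_condLaw, ← mul_assoc, mul_div_cancel₀ _ (hQ q).ne']

lemma condEntropy_comp_fst_le [DecidableEq α] [Fintype β] [DecidableEq β] (hP : ∀ ω, 0 ≤ P ω)
    (hQ : ∀ q, 0 < law P Prod.snd q) (V : α → β) :
    condEntropy P (fun ω => V ω.1) Prod.snd ≤ condEntropy P Prod.fst Prod.snd := by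
  rw [condEntropy_eq_sum_condLaw hP hQ V]
  refine le_of_le_of_eq ?_ (condEntropy_eq_sum_condLaw hP hQ id).symm
  gcongr with q
  exacts [(hQ q).le, condEntropy_le_condEntropy_id (condLaw_mem_stdSimplex hP (hQ q)).1 V _]

end CondLaw

section LogSpread

variable {Ω α β : Type*} [Fintype Ω] [DecidableEq β] {P : Ω → ℝ}

/-- The mean over all outcomes of `|log₂ P(ω | W)|`: the fluctuation of the information density
along an `ε`-typical sequence is at most `ε * logSpread P W` per letter. -/
noncomputable def logSpread (P : Ω → ℝ) (W : Ω → β) : ℝ :=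
  (∑ ω, |Real.logb 2 (condProb P W ω)|) / Fintype.card Ω

lemma logSpread_nonneg (P : Ω → ℝ) (W : Ω → β) : 0 ≤ logSpread P W := by
  unfold logSpread; positivity

lemma logSpread_pair_le [DecidableEq α] (hP : ∀ ω, 0 ≤ P ω) (V : Ω → α) (W : Ω → β) :
    logSpread P (fun ω => (V ω, W ω)) ≤ logSpread P W := by
  unfold logSpread
  refine div_le_div_of_nonneg_right (sum_le_sum fun ω _ => ?_) (Nat.cast_nonneg _)
  rcases (hP ω).eq_or_lt with hω | hω
  · simp [condProb, ← hω]
  · exact abs_le_abs_of_nonpos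
      (Real.logb_nonpos one_lt_two (condProb_nonneg hP _ ω) (condProb_le_one hP _ ω)) <|
      Real.logb_le_logb_of_le one_lt_two (condProb_pos hP W hω)
        (condProb_le_condProb_pair hP V W ω)

end LogSpread

section AsymptoticEquipartition

variable {Ω β : Type*} [Fintype Ω] [DecidableEq Ω] [DecidableEq β] {P : Ω → ℝ} {ε : ℝ}
  {n : ℕ} {x : Fin n → Ω}

lemma sum_comp_eq_sum_occurrences (x : Fin n → Ω) (h : Ω → ℝ) :
    ∑ i, h (x i) = ∑ a, occurrences a x * h a := by
  rw [← sum_fiberwise univ x]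
  refine sum_congr rfl fun a _ => ?_
  rw [sum_congr rfl fun i hi => congrArg h (mem_filter.1 hi).2, sum_const, nsmul_eq_mul,
    occurrences]

lemma IsTypical.abs_sum_sub_le (hx : IsTypical P ε x) (h : Ω → ℝ) :
    |∑ i, h (x i) - n * ∑ a, P a * h a| ≤ n * (ε * ((∑ a, |h a|) / Fintype.card Ω)) := by
  rcases n.eq_zero_or_pos with rfl | hn
  · simp
  have hn' : (n : ℝ) ≠ 0 := by exact_mod_cast hn.ne'
  calc |∑ i, h (x i) - n * ∑ a, P a * h a|
      = |n * ∑ a, (occurrences a x / n - P a) * h a| := by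
        rw [sum_comp_eq_sum_occurrences, mul_sum, mul_sum, ← sum_sub_distrib]
        refine congrArg _ (sum_congr rfl fun a _ => ?_)
        field_simp
    _ = n * |∑ a, (occurrences a x / n - P a) * h a| := by simp [abs_mul]
    _ ≤ n * ∑ a, ε / Fintype.card Ω * |h a| := by
        gcongr
        refine (abs_sum_le_sum_abs _ _).trans (sum_le_sum fun a _ => ?_)
        rw [abs_mul]
        exact mul_le_mul_of_nonneg_right (hx.1 a) (abs_nonneg _)
    _ = n * (ε * ((∑ a, |h a|) / Fintype.card Ω)) := by rw [← mul_sum]; ring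

lemma IsTypical.pos (hP : ∀ ω, 0 ≤ P ω) (hx : IsTypical P ε x) (i : Fin n) : 0 < P (x i) :=
  (hP _).lt_of_ne fun h => hx.2 _ h.symm i rfl

lemma IsTypical.prod_condProb_eq (hP : ∀ ω, 0 ≤ P ω) (W : Ω → β) (hx : IsTypical P ε x) :
    ∏ i, condProb P W (x i) = (2 : ℝ) ^ ∑ i, Real.logb 2 (condProb P W (x i)) := by
  rw [Real.rpow_sum_of_pos two_pos]
  exact prod_congr rfl fun i _ =>
    (Real.rpow_logb two_pos (by norm_num) (condProb_pos hP W (hx.pos hP i))).symm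

variable [Fintype β]

lemma IsTypical.abs_sum_logb_condProb_add_le (W : Ω → β) (hx : IsTypical P ε x) :
    |∑ i, Real.logb 2 (condProb P W (x i)) + n * condEntropy P id W| ≤
      n * (ε * logSpread P W) := by
  rw [condEntropy_id, mul_neg, ← sub_eq_add_neg]
  exact hx.abs_sum_sub_le fun ω => Real.logb 2 (condProb P W ω)

lemma IsTypical.le_prod_condProb (hP : ∀ ω, 0 ≤ P ω) (W : Ω → β) (hx : IsTypical P ε x) :
    (2 : ℝ) ^ (-(n * (condEntropy P id W + ε * logSpread P W))) ≤ ∏ i, condProb P W (x i) := by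
  rw [hx.prod_condProb_eq hP]
  exact Real.rpow_le_rpow_of_exponent_le one_le_two <| by
    linarith [neg_le_of_abs_le (hx.abs_sum_logb_condProb_add_le W)]

lemma IsTypical.prod_condProb_le (hP : ∀ ω, 0 ≤ P ω) (W : Ω → β) (hx : IsTypical P ε x) :
    ∏ i, condProb P W (x i) ≤ (2 : ℝ) ^ (-(n * (condEntropy P id W - ε * logSpread P W))) := by
  rw [hx.prod_condProb_eq hP]
  exact Real.rpow_le_rpow_of_exponent_le one_le_two <| by
    linarith [le_of_abs_le (hx.abs_sum_logb_condProb_add_le W)]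

end AsymptoticEquipartition

section CollisionProbability

variable {Y Z : Type*}

open Classical in
/-- The probability that two independent uniformly distributed elements of `S` have the same
image under `g`. -/
noncomputable def collisionProb (g : Y → Z) (S : Finset Y) : ℝ :=
  #{yy ∈ S ×ˢ S | g yy.1 = g yy.2} / (#S : ℝ) ^ 2

lemma card_collisions [DecidableEq Z] (g : Y → Z) (S : Finset Y) :
    (#{yy ∈ S ×ˢ S | g yy.1 = g yy.2} : ℝ) = collisionProb g S * #S ^ 2 := by
  rcases S.eq_empty_or_nonempty with rfl | hS
  · simp
  · have : (#S : ℝ) ≠ 0 := by exact_mod_cast hS.card_ne_zero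
    rw [collisionProb, div_mul_cancel₀ _ (pow_ne_zero 2 this)]
    congr!

lemma collisionProb_nonneg (g : Y → Z) (S : Finset Y) : 0 ≤ collisionProb g S := by
  unfold collisionProb; positivity

lemma collisionProb_le_one (g : Y → Z) (S : Finset Y) : collisionProb g S ≤ 1 := by
  classical
  refine div_le_one_of_le₀ ?_ (sq_nonneg _)
  exact_mod_cast (card_filter_le _ _).trans_eq (by rw [card_product, sq])

lemma collisionProb_mono {Z' : Type*} {g : Y → Z} {g' : Y → Z'}
    (h : ∀ y y', g y = g y' → g' y = g' y') (S : Finset Y) :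
    collisionProb g S ≤ collisionProb g' S := by
  unfold collisionProb
  gcongr with yy
  exact h _ _

open Classical in
lemma collisionProb_le_div {g : Y → Z} {S : Finset Y} {B : ℝ}
    (hB : ∀ y ∈ S, #{y' ∈ S | g y = g y'} ≤ B) : collisionProb g S ≤ B / #S := by
  have hpairs : (#{yy ∈ S ×ˢ S | g yy.1 = g yy.2} : ℝ) = ∑ y ∈ S, (#{y' ∈ S | g y = g y'} : ℝ) := by
    simp only [card_filter, sum_product, Nat.cast_sum]
  calc collisionProb g S ≤ (∑ _y ∈ S, B) / #S ^ 2 := by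
        rw [collisionProb, hpairs]
        gcongr with y hy
        exact hB y hy
    _ = B / #S := by
        rw [sum_const, nsmul_eq_mul, sq]
        rcases S.eq_empty_or_nonempty with rfl | hS
        · simp
        · have : (#S : ℝ) ≠ 0 := by exact_mod_cast hS.card_ne_zero
          field_simp

lemma collisionProb_map {Y' : Type*} (g : Y → Z) (e : Y' ↪ Y) (S : Finset Y') :
    collisionProb g (S.map e) = collisionProb (g ∘ e) S := by
  classical
  have : S.map e ×ˢ S.map e = (S ×ˢ S).map (e.prodMap e) := by
    ext ⟨y, y'⟩; aesop
  rw [collisionProb, collisionProb, card_map, this, filter_map, card_map]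
  rfl

lemma collisionProb_piFinset {ι : Type*} [Fintype ι] [DecidableEq ι] {Y Z : ι → Type*}
    (g : ∀ i, Y i → Z i) (S : ∀ i, Finset (Y i)) :
    collisionProb (fun y i => g i (y i)) (Fintype.piFinset S) = ∏ i, collisionProb (g i) (S i) := by
  classical
  have hpairs : #{yy ∈ Fintype.piFinset S ×ˢ Fintype.piFinset S |
      (fun i => g i (yy.1 i)) = fun i => g i (yy.2 i)} =
      #(Fintype.piFinset fun i => {yy ∈ S i ×ˢ S i | g i yy.1 = g i yy.2}) := by
    refine card_equiv (Equiv.arrowProdEquivProdArrow _ _ _).symm fun yy => ?_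
    simp only [mem_filter, mem_product, Fintype.mem_piFinset, funext_iff,
      Equiv.arrowProdEquivProdArrow, Equiv.coe_fn_symm_mk]
    grind
  simp only [collisionProb, hpairs, Fintype.card_piFinset, Nat.cast_prod, ← prod_pow,
    prod_div_distrib]

end CollisionProbability

section TypicalFiber

variable {Ω β : Type*} [Fintype Ω] [DecidableEq β] {P : Ω → ℝ} {W : Ω → β} {ε : ℝ} {n : ℕ}
  {w : Fin n → β}

lemma filter_comp_eq_piFinset (W : Ω → β) (w : Fin n → β) :
    ({v | W ∘ v = w} : Finset (Fin n → Ω)) = Fintype.piFinset fun i => {ω | W ω = w i} := by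
  ext v; simp [funext_iff]

lemma sum_filter_comp_prod (P : Ω → ℝ) (W : Ω → β) (w : Fin n → β) :
    ∑ v : Fin n → Ω with W ∘ v = w, ∏ i, P (v i) = ∏ i, law P W (w i) := by
  simp only [filter_comp_eq_piFinset, law, prod_univ_sum]

variable [DecidableEq Ω]

/-- The `ε`-typical sequences on which `W` takes the values `w`. -/
noncomputable def typicalFiber (P : Ω → ℝ) (W : Ω → β) (ε : ℝ) {n : ℕ} (w : Fin n → β) :
    Finset (Fin n → Ω) :=
  {v ∈ typicalSet P ε n | W ∘ v = w}

/-- The conditional probability that an i.i.d. sequence is `ε`-typical, given that `W` takes the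
values `w` on it. -/
noncomputable def condTypicalProb (P : Ω → ℝ) (W : Ω → β) (ε : ℝ) {n : ℕ} (w : Fin n → β) : ℝ :=
  ∑ v ∈ typicalFiber P W ε w, ∏ i, condProb P W (v i)

lemma isTypical_of_mem_typicalFiber {v : Fin n → Ω} (hv : v ∈ typicalFiber P W ε w) :
    IsTypical P ε v :=
  mem_typicalSet.1 (mem_filter.1 hv).1

lemma condTypicalProb_le_one (hP : ∀ ω, 0 ≤ P ω) : condTypicalProb P W ε w ≤ 1 := by
  calc condTypicalProb P W ε w ≤ ∑ v : Fin n → Ω with W ∘ v = w, ∏ i, condProb P W (v i) :=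
        sum_le_sum_of_subset_of_nonneg (filter_subset_filter _ (subset_univ _)) fun v _ _ =>
          prod_nonneg fun i _ => condProb_nonneg hP W (v i)
    _ = ∏ i, ∑ ω with W ω = w i, condProb P W ω := by
        rw [filter_comp_eq_piFinset, prod_univ_sum]
    _ ≤ 1 := prod_le_one (fun i _ => sum_nonneg fun ω _ => condProb_nonneg hP W ω) fun i _ =>
        sum_condProb_fiber_le_one P W (w i)

lemma typicalFiber_nonempty (hw : 1 / 2 ≤ condTypicalProb P W ε w) :
    (typicalFiber P W ε w).Nonempty :=
  nonempty_of_sum_ne_zero (ne_of_gt (one_half_pos.trans_le hw))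

lemma sum_typicalFiber_prod (hP : ∀ ω, 0 ≤ P ω) (W : Ω → β) (ε : ℝ) (w : Fin n → β) :
    ∑ v ∈ typicalFiber P W ε w, ∏ i, P (v i) =
      condTypicalProb P W ε w * ∏ i, law P W (w i) := by
  rw [condTypicalProb, sum_mul]
  refine sum_congr rfl fun v hv => ?_
  rw [← (mem_filter.1 hv).2, ← prod_mul_distrib]
  exact prod_congr rfl fun i _ => (condProb_mul_law hP W (v i)).symm

variable [Fintype β]

lemma card_typicalFiber_le (hP : ∀ ω, 0 ≤ P ω) :
    (#(typicalFiber P W ε w) : ℝ) ≤ 2 ^ (n * (condEntropy P id W + ε * logSpread P W)) := by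
  have hmass : #(typicalFiber P W ε w) *
      (2 : ℝ) ^ (-(n * (condEntropy P id W + ε * logSpread P W))) ≤ 1 := by
    rw [← nsmul_eq_mul]
    exact (card_nsmul_le_sum _ _ _ fun v hv =>
      (isTypical_of_mem_typicalFiber hv).le_prod_condProb hP W).trans (condTypicalProb_le_one hP)
  rwa [Real.rpow_neg two_pos.le, ← div_eq_mul_inv, div_le_one (by positivity)] at hmass

lemma condTypicalProb_le_card_mul (hP : ∀ ω, 0 ≤ P ω) :
    condTypicalProb P W ε w ≤
      #(typicalFiber P W ε w) * 2 ^ (-(n * (condEntropy P id W - ε * logSpread P W))) := by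
  rw [← nsmul_eq_mul]
  exact sum_le_card_nsmul _ _ _ fun v hv =>
    (isTypical_of_mem_typicalFiber hv).prod_condProb_le hP W

variable {α : Type*} [Fintype α] [DecidableEq α]

lemma card_typicalFiber_filter_comp_le (hP : ∀ ω, 0 ≤ P ω) (hε : 0 ≤ ε) (V : Ω → α)
    (a : Fin n → α) :
    (#{v ∈ typicalFiber P W ε w | a = V ∘ v} : ℝ) ≤
      2 ^ (n * (condEntropy P id (fun ω => (V ω, W ω)) + ε * logSpread P W)) := by
  have hsub : {v ∈ typicalFiber P W ε w | a = V ∘ v} ⊆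
      typicalFiber P (fun ω => (V ω, W ω)) ε fun i => (a i, w i) := by
    intro v hv
    obtain ⟨hvw, rfl⟩ := mem_filter.1 hv
    obtain ⟨htypical, rfl⟩ := mem_filter.1 hvw
    exact mem_filter.2 ⟨htypical, rfl⟩
  calc (#{v ∈ typicalFiber P W ε w | a = V ∘ v} : ℝ)
      ≤ #(typicalFiber P (fun ω => (V ω, W ω)) ε fun i => (a i, w i)) := by
        exact_mod_cast card_le_card hsub
    _ ≤ _ := card_typicalFiber_le hP
    _ ≤ _ := by
        gcongr
        · norm_num
        · exact logSpread_pair_le hP V W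

lemma collisionProb_typicalFiber_le (hP : ∀ ω, 0 ≤ P ω) (hε : 0 ≤ ε)
    (hw : 1 / 2 ≤ condTypicalProb P W ε w) (V : Ω → α) :
    collisionProb (fun v => V ∘ v) (typicalFiber P W ε w) ≤
      2 * 2 ^ (-(n * (condEntropy P V W - 2 * (ε * logSpread P W)))) := by
  set A := ε * logSpread P W
  have hcard : (0 : ℝ) < #(typicalFiber P W ε w) := by
    exact_mod_cast (typicalFiber_nonempty hw).card_pos
  have hsplit : -(n * (condEntropy P V W - 2 * A)) =
      n * (condEntropy P id (fun ω => (V ω, W ω)) + A) + -(n * (condEntropy P id W - A)) := by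
    rw [condEntropy_id_eq_add hP V W]; ring
  calc collisionProb (fun v => V ∘ v) (typicalFiber P W ε w)
      ≤ 2 ^ (n * (condEntropy P id (fun ω => (V ω, W ω)) + A)) / #(typicalFiber P W ε w) := by
        classical
        exact collisionProb_le_div fun v _ => by
          convert card_typicalFiber_filter_comp_le hP hε V (V ∘ v)
    _ ≤ 2 ^ (n * (condEntropy P id (fun ω => (V ω, W ω)) + A)) *
          (2 * 2 ^ (-(n * (condEntropy P id W - A)))) := by
        rw [div_eq_mul_inv]
        gcongr
        rw [inv_le_iff_one_le_mul₀' hcard]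
        linarith [hw.trans (condTypicalProb_le_card_mul hP)]
    _ = 2 * 2 ^ (-(n * (condEntropy P V W - 2 * A))) := by
        rw [hsplit, Real.rpow_add two_pos]; ring

end TypicalFiber

section Markov

variable {Ω β : Type*} [Fintype Ω] [DecidableEq Ω] [Fintype β] [DecidableEq β] {P : Ω → ℝ}

lemma sum_prod_law_condTypicalProb_lt_half_le (hP : ∀ ω, 0 ≤ P ω) (W : Ω → β) (ε : ℝ) (n : ℕ) :
    ∑ w : Fin n → β with condTypicalProb P W ε w < 1 / 2, ∏ i, law P W (w i) ≤
      2 * ∑ v ∈ (typicalSet P ε n)ᶜ, ∏ i, P (v i) := by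
  have hprod (v : Fin n → Ω) : 0 ≤ ∏ i, P (v i) := prod_nonneg fun i _ => hP _
  have hfiber (w : Fin n → β) : ∑ v ∈ (typicalSet P ε n)ᶜ with W ∘ v = w, ∏ i, P (v i) =
      (1 - condTypicalProb P W ε w) * ∏ i, law P W (w i) := by
    have htypical : {v ∈ univ.filter (W ∘ · = w) | v ∈ typicalSet P ε n} =
        typicalFiber P W ε w := by
      ext; simp [typicalFiber, and_comm]
    have hatypical : {v ∈ univ.filter (W ∘ · = w) | v ∉ typicalSet P ε n} =
        {v ∈ (typicalSet P ε n)ᶜ | W ∘ v = w} := by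
      ext; simp [and_comm]
    have hsplit := sum_filter_add_sum_filter_not (univ.filter (W ∘ · = w))
      (· ∈ typicalSet P ε n) fun v => ∏ i, P (v i)
    rw [htypical, hatypical, sum_typicalFiber_prod hP, sum_filter_comp_prod] at hsplit
    linarith
  calc _ ≤ ∑ w : Fin n → β with condTypicalProb P W ε w < 1 / 2,
          2 * ∑ v ∈ (typicalSet P ε n)ᶜ with W ∘ v = w, ∏ i, P (v i) := by
        refine sum_le_sum fun w hw => ?_
        rw [hfiber]
        have hlaw : 0 ≤ ∏ i, law P W (w i) := by
          rw [← sum_filter_comp_prod]; exact sum_nonneg fun v _ => hprod v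
        nlinarith [(mem_filter.1 hw).2]
    _ ≤ ∑ w : Fin n → β, 2 * ∑ v ∈ (typicalSet P ε n)ᶜ with W ∘ v = w, ∏ i, P (v i) :=
        sum_le_univ_sum_of_nonneg fun w => mul_nonneg two_pos.le (sum_nonneg fun v _ => hprod v)
    _ = 2 * ∑ v ∈ (typicalSet P ε n)ᶜ, ∏ i, P (v i) := by
        rw [← mul_sum, sum_fiberwise]

lemma eventually_sum_prod_law_condTypicalProb_lt_half_lt (hP : P ∈ stdSimplex ℝ Ω) (W : Ω → β)
    {ε : ℝ} (hε : 0 < ε) {δ : ℝ} (hδ : 0 < δ) :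
    ∀ᶠ n in atTop, ∑ w : Fin n → β with condTypicalProb P W ε w < 1 / 2,
      ∏ i, law P W (w i) < δ := by
  filter_upwards [eventually_sum_prod_compl_typicalSet_lt hP hε (half_pos hδ)] with n hn
  linarith [sum_prod_law_condTypicalProb_lt_half_le hP.1 W ε n]

end Markov

section TypicalSet

variable {Ω α : Type*} [Fintype Ω] [DecidableEq Ω] [Fintype α] [DecidableEq α] {P : Ω → ℝ} {ε : ℝ}

lemma typicalFiber_const (P : Ω → ℝ) (ε : ℝ) {n : ℕ} (w : Fin n → Unit) :
    typicalFiber P (fun _ => ()) ε w = typicalSet P ε n :=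
  filter_true_of_mem fun _ _ => rfl

lemma card_typicalSet_le (hP : ∀ ω, 0 ≤ P ω) (ε : ℝ) (n : ℕ) :
    (#(typicalSet P ε n) : ℝ) ≤
      2 ^ (n * (condEntropy P id (fun _ => ()) + ε * logSpread P fun _ => ())) := by
  rw [← typicalFiber_const P ε fun _ => ()]
  exact card_typicalFiber_le hP

lemma eventually_half_le_condTypicalProb_const (hP : P ∈ stdSimplex ℝ Ω) (hε : 0 < ε) :
    ∀ᶠ n : ℕ in atTop, ∀ w : Fin n → Unit, 1 / 2 ≤ condTypicalProb P (fun _ => ()) ε w := by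
  filter_upwards [eventually_sum_prod_law_condTypicalProb_lt_half_lt hP (fun _ => ()) hε one_pos]
    with n hn
  have law_const : law P (fun _ => ()) () = 1 := by simpa [law] using hP.2
  simpa [law_const, Unique.forall_iff] using hn

lemma eventually_typicalSet_nonempty (hP : P ∈ stdSimplex ℝ Ω) (hε : 0 < ε) :
    ∀ᶠ n in atTop, (typicalSet P ε n).Nonempty := by
  filter_upwards [eventually_half_le_condTypicalProb_const hP hε] with n hn
  rw [← typicalFiber_const P ε fun _ => ()]
  exact typicalFiber_nonempty (hn _)

lemma eventually_collisionProb_typicalSet_le (hP : P ∈ stdSimplex ℝ Ω) (hε : 0 < ε) (V : Ω → α) :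
    ∀ᶠ n : ℕ in atTop, collisionProb (fun v => V ∘ v) (typicalSet P ε n) ≤
      2 * 2 ^ (-(n * (condEntropy P V (fun _ => ()) - 2 * (ε * logSpread P fun _ => ())))) := by
  filter_upwards [eventually_half_le_condTypicalProb_const hP hε] with n hn
  rw [← typicalFiber_const P ε fun _ => ()]
  exact collisionProb_typicalFiber_le hP.1 hε.le (hn _) V

end TypicalSet

section BlockLengths

variable {Q : Type*} {L : Q → ℝ} {c : ℝ}

lemma eventually_forall_blockLength [Finite Q] (hL : ∀ q, 0 < L q) (hc : 0 < c) {p : Q → ℕ → Prop}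
    (hp : ∀ q, ∀ᶠ k in atTop, p q k) :
    ∀ᶠ n : ℕ in atTop, ∀ k : Q → ℕ, (∀ q, |(k q : ℝ) - L q * (c * n)| < 1) → ∀ q, p q (k q) := by
  have hlarge (q : Q) : ∀ᶠ n : ℕ in atTop, ∀ k : ℕ, |(k : ℝ) - L q * (c * n)| < 1 → p q k := by
    obtain ⟨K, hK⟩ := eventually_atTop.1 (hp q)
    have hlim : Tendsto (fun n : ℕ => L q * (c * n)) atTop atTop :=
      (tendsto_natCast_atTop_atTop.const_mul_atTop hc).const_mul_atTop (hL q)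
    filter_upwards [hlim.eventually_ge_atTop (K + 1)] with n hn k hk
    exact hK k <| by exact_mod_cast (by linarith [neg_lt_of_abs_lt hk] : (K : ℝ) ≤ k)
  filter_upwards [eventually_all.2 hlarge] with n hn k hk q using hn q _ (hk q)

lemma eventually_sum_blockLength_mul_le [Fintype Q] (L : Q → ℝ) (c : ℝ) (b : Q → ℝ) (C : ℝ) {ε : ℝ}
    (hε : 0 < ε) :
    ∀ᶠ n : ℕ in atTop, ∀ k : Q → ℕ, (∀ q, |(k q : ℝ) - L q * (c * n)| < 1) →
      C + ∑ q, k q * b q ≤ n * (c * ∑ q, L q * b q + ε) := by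
  have hlim : Tendsto (fun n : ℕ => ε * (n : ℝ)) atTop atTop :=
    tendsto_natCast_atTop_atTop.const_mul_atTop hε
  filter_upwards [hlim.eventually_ge_atTop (C + ∑ q, |b q|)] with n hn k hk
  have hround : ∑ q, k q * b q ≤ ∑ q, (L q * (c * n) * b q + |b q|) := by
    refine sum_le_sum fun q _ => ?_
    have := (le_abs_self _).trans_eq (abs_mul (k q - L q * (c * n)) (b q))
    nlinarith [hk q, abs_nonneg (b q)]
  calc C + ∑ q, k q * b q ≤ (C + ∑ q, |b q|) + ∑ q, L q * (c * n) * b q := by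
        rw [sum_add_distrib] at hround; linarith
    _ ≤ ε * n + n * (c * ∑ q, L q * b q) := by
        gcongr
        rw [mul_sum, mul_sum]
        exact (sum_congr rfl fun q _ => by ring).le
    _ = n * (c * ∑ q, L q * b q + ε) := by ring

end BlockLengths

section CondLogSpread

variable {α β Q : Type*} [Fintype α] [Fintype Q] [DecidableEq Q] {P : α × Q → ℝ}

/-- The average over `q` of the spreads `logSpread` of the conditional laws given `Q = q`. -/
noncomputable def condLogSpread (P : α × Q → ℝ) : ℝ :=
  ∑ q, law P Prod.snd q * logSpread (condLaw P q) fun _ => ()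

lemma condLogSpread_nonneg (hQ : ∀ q, 0 < law P Prod.snd q) : 0 ≤ condLogSpread P :=
  sum_nonneg fun q _ => mul_nonneg (hQ q).le (logSpread_nonneg _ _)

lemma sum_law_mul_condEntropy_add [Fintype β] [DecidableEq β] (hP : ∀ ω, 0 ≤ P ω)
    (hQ : ∀ q, 0 < law P Prod.snd q) (V : α → β) (t : ℝ) :
    ∑ q, law P Prod.snd q * (condEntropy (condLaw P q) V (fun _ => ()) +
        t * logSpread (condLaw P q) fun _ => ()) =
      condEntropy P (fun ω => V ω.1) Prod.snd + t * condLogSpread P := by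
  simp only [condEntropy_eq_sum_condLaw hP hQ, condLogSpread, mul_add, sum_add_distrib, mul_sum,
    mul_left_comm t]

end CondLogSpread

section IndexSet

variable {α β Q : Type*} [Fintype α] [DecidableEq α] [Fintype Q] [DecidableEq Q]
  {P : α × Q → ℝ} {c ε : ℝ}

/-- The index set of a quasi group code, as a finset and over an arbitrary alphabet. -/
noncomputable def indexFinset (P : α × Q → ℝ) (ε : ℝ) (k : Q → ℕ) :
    Finset ((Σ q, Fin (k q)) → α) :=
  (Fintype.piFinset fun q => typicalSet (condLaw P q) ε (k q)).map
    (Equiv.piCurry fun _ _ => α).symm.toEmbedding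

lemma mem_indexFinset {k : Q → ℕ} {u : (Σ q, Fin (k q)) → α} :
    u ∈ indexFinset P ε k ↔ ∀ q, IsTypical (condLaw P q) ε fun j => u ⟨q, j⟩ := by
  rw [indexFinset, mem_map_equiv, Equiv.symm_symm, Fintype.mem_piFinset]
  exact forall_congr' fun q => mem_typicalSet

lemma coe_indexFinset {m : ℕ} [NeZero m] (P : ZMod m × Q → ℝ) (ε : ℝ) (k : Q → ℕ) :
    (indexFinset P ε k : Set ((Σ q, Fin (k q)) → ZMod m)) = indexSet P ε k :=
  Set.ext fun _ => mem_indexFinset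

lemma card_indexFinset (P : α × Q → ℝ) (ε : ℝ) (k : Q → ℕ) :
    #(indexFinset P ε k) = ∏ q, #(typicalSet (condLaw P q) ε (k q)) := by
  rw [indexFinset, card_map, Fintype.card_piFinset]

lemma collisionProb_indexFinset_le (P : α × Q → ℝ) (ε : ℝ) (k : Q → ℕ) (V : α → β) :
    collisionProb (fun u => V ∘ u) (indexFinset P ε k) ≤
      ∏ q, collisionProb (fun v => V ∘ v) (typicalSet (condLaw P q) ε (k q)) := by
  rw [indexFinset, collisionProb_map, ← collisionProb_piFinset]
  exact collisionProb_mono (fun y y' h => funext fun q => funext fun j => congrFun h ⟨q, j⟩) _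

lemma eventually_indexFinset_nonempty (hP : ∀ ω, 0 ≤ P ω) (hQ : ∀ q, 0 < law P Prod.snd q)
    (hc : 0 < c) (hε : 0 < ε) :
    ∀ᶠ n : ℕ in atTop, ∀ k : Q → ℕ, (∀ q, |(k q : ℝ) - law P Prod.snd q * (c * n)| < 1) →
      (indexFinset P ε k).Nonempty := by
  filter_upwards [eventually_forall_blockLength hQ hc fun q =>
    eventually_typicalSet_nonempty (condLaw_mem_stdSimplex hP (hQ q)) hε] with n hn k hk
  exact (Fintype.piFinset_nonempty.2 (hn k hk)).map

lemma eventually_card_indexFinset_le (hP : ∀ ω, 0 ≤ P ω) (hQ : ∀ q, 0 < law P Prod.snd q)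
    (c : ℝ) (hε : 0 < ε) :
    ∀ᶠ n : ℕ in atTop, ∀ k : Q → ℕ, (∀ q, |(k q : ℝ) - law P Prod.snd q * (c * n)| < 1) →
      (#(indexFinset P ε k) : ℝ) ≤
        2 ^ (n * (c * condEntropy P Prod.fst Prod.snd + ε * (c * condLogSpread P + 1))) := by
  filter_upwards [eventually_sum_blockLength_mul_le (law P Prod.snd) c
    (fun q => condEntropy (condLaw P q) id (fun _ => ()) +
      ε * logSpread (condLaw P q) fun _ => ()) 0 hε] with n hn k hk
  calc (#(indexFinset P ε k) : ℝ)
      ≤ ∏ q, (2 : ℝ) ^ (k q * (condEntropy (condLaw P q) id (fun _ => ()) +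
          ε * logSpread (condLaw P q) fun _ => ())) := by
        rw [card_indexFinset, Nat.cast_prod]
        exact prod_le_prod (fun q _ => Nat.cast_nonneg _) fun q _ =>
          card_typicalSet_le (condLaw_mem_stdSimplex hP (hQ q)).1 ε (k q)
    _ = 2 ^ ∑ q, k q * (condEntropy (condLaw P q) id (fun _ => ()) +
          ε * logSpread (condLaw P q) fun _ => ()) := (Real.rpow_sum_of_pos two_pos _ _).symm
    _ ≤ _ := by
        refine Real.rpow_le_rpow_of_exponent_le one_le_two ?_
        have hmean := sum_law_mul_condEntropy_add hP hQ id ε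
        have hsum := hn k hk
        rw [hmean, zero_add] at hsum
        refine hsum.trans_eq ?_
        change n * (c * (condEntropy P Prod.fst Prod.snd + ε * condLogSpread P) + ε) = _
        ring

lemma eventually_collisionProb_indexFinset_le [Fintype β] [DecidableEq β] (hP : ∀ ω, 0 ≤ P ω)
    (hQ : ∀ q, 0 < law P Prod.snd q) (hc : 0 < c) (hε : 0 < ε) (V : α → β) :
    ∀ᶠ n : ℕ in atTop, ∀ k : Q → ℕ, (∀ q, |(k q : ℝ) - law P Prod.snd q * (c * n)| < 1) →
      collisionProb (fun u => V ∘ u) (indexFinset P ε k) ≤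
        2 ^ (-(n * (c * condEntropy P (fun ω => V ω.1) Prod.snd -
          ε * (2 * c * condLogSpread P + 1)))) := by
  let b : Q → ℝ := fun q => -(condEntropy (condLaw P q) V (fun _ => ()) +
    -(2 * ε) * logSpread (condLaw P q) fun _ => ())
  filter_upwards [eventually_sum_blockLength_mul_le (law P Prod.snd) c b (Fintype.card Q) hε,
    eventually_forall_blockLength hQ hc fun q =>
      eventually_collisionProb_typicalSet_le (condLaw_mem_stdSimplex hP (hQ q)) hε V]
    with n hsum hcollision k hk
  calc collisionProb (fun u => V ∘ u) (indexFinset P ε k)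
      ≤ ∏ q, 2 * (2 : ℝ) ^ (k q * b q) := by
        refine (collisionProb_indexFinset_le P ε k V).trans ?_
        refine prod_le_prod (fun q _ => collisionProb_nonneg _ _) fun q _ => ?_
        refine (hcollision k hk q).trans_eq ?_
        simp only [b]
        ring_nf
    _ = 2 ^ (Fintype.card Q + ∑ q, k q * b q) := by
        rw [prod_mul_distrib, ← Real.rpow_sum_of_pos two_pos, Real.rpow_add two_pos, prod_const,
          card_univ, Real.rpow_natCast]
    _ ≤ _ := by
        refine Real.rpow_le_rpow_of_exponent_le one_le_two ((hsum k hk).trans_eq ?_)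
        simp only [b, mul_neg, sum_neg_distrib, sum_law_mul_condEntropy_add hP hQ]
        ring

end IndexSet

section SecondMoment

variable {R ι κ : Type*} [CommRing R]

/-- The ideal generated by the coordinates of `u - u'`. -/
def diffIdeal (u u' : ι → R) : Ideal R :=
  Ideal.span (Set.range (u - u'))

lemma mk_comp_eq_of_diffIdeal_le {I : Ideal R} {u u' : ι → R} (h : diffIdeal u u' ≤ I) :
    Ideal.Quotient.mk I ∘ u = Ideal.Quotient.mk I ∘ u' :=
  funext fun i => Ideal.Quotient.eq.2 (h (Ideal.subset_span ⟨i, rfl⟩))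

open scoped Classical in
lemma sum_diffIdeal_le [Fintype (Ideal R)] (U : Finset (ι → R)) {w : Ideal R → ℝ}
    (hw : ∀ I, 0 ≤ w I) :
    ∑ uu ∈ U ×ˢ U, w (diffIdeal uu.1 uu.2) ≤
      #U ^ 2 *
        (w ⊤ + ∑ I with I ≠ ⊤, collisionProb (fun u => Ideal.Quotient.mk I ∘ u) U * w I) := by
  have hcount (I : Ideal R) : (#{uu ∈ U ×ˢ U | diffIdeal uu.1 uu.2 = I} : ℝ) ≤
      collisionProb (fun u => Ideal.Quotient.mk I ∘ u) U * #U ^ 2 := by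
    rw [← card_collisions]
    exact_mod_cast card_le_card fun uu huu => mem_filter.2
      ⟨(mem_filter.1 huu).1, mk_comp_eq_of_diffIdeal_le (le_of_eq (mem_filter.1 huu).2)⟩
  have htop : (#{uu ∈ U ×ˢ U | diffIdeal uu.1 uu.2 = ⊤} : ℝ) ≤ #U ^ 2 := by
    exact_mod_cast (card_filter_le _ _).trans_eq (by rw [card_product, sq])
  calc ∑ uu ∈ U ×ˢ U, w (diffIdeal uu.1 uu.2)
      = ∑ I, #{uu ∈ U ×ˢ U | diffIdeal uu.1 uu.2 = I} * w I := by
        rw [← sum_fiberwise (U ×ˢ U) (fun uu => diffIdeal uu.1 uu.2)]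
        refine sum_congr rfl fun I _ => ?_
        rw [← nsmul_eq_mul, ← sum_const]
        exact sum_congr rfl fun uu huu => by rw [(mem_filter.1 huu).2]
    _ = #{uu ∈ U ×ˢ U | diffIdeal uu.1 uu.2 = ⊤} * w ⊤ +
          ∑ I with I ≠ ⊤, #{uu ∈ U ×ˢ U | diffIdeal uu.1 uu.2 = I} * w I := by
        rw [filter_ne', add_sum_erase _ (fun I => #{uu ∈ U ×ˢ U | diffIdeal uu.1 uu.2 = I} * w I)
          (mem_univ _)]
    _ ≤ #U ^ 2 * w ⊤ + ∑ I with I ≠ ⊤,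
          collisionProb (fun u => Ideal.Quotient.mk I ∘ u) U * #U ^ 2 * w I := by
        gcongr with I
        exacts [hw _, hw I, hcount I]
    _ = _ := by
        rw [mul_add, mul_sum]
        simp only [mul_comm, mul_left_comm]

variable [Fintype ι]

lemma vecMul_mem_diffIdeal (u u' : ι → R) (G : Matrix ι κ R) (j : κ) :
    ((u - u') ᵥ* G) j ∈ diffIdeal u u' :=
  Ideal.mem_span_range_iff_exists_fun.2 ⟨fun i => G i j, by
    simp only [Matrix.vecMul, dotProduct, mul_comm]⟩

variable [Fintype R] [DecidableEq R] [DecidableEq ι] [Fintype κ] [DecidableEq κ]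

-- Adding to `G` matrices `E` with prescribed `d ᵥ* E` makes the fibers of `G ↦ d ᵥ* G` over the
-- vectors with entries in the ideal equally large.
lemma card_vecMul_eq_mul_pow_le (d : ι → R) (z : κ → R) :
    #{G : Matrix ι κ R | d ᵥ* G = z} * Nat.card (Ideal.span (Set.range d)) ^ Fintype.card κ ≤
      Fintype.card (Matrix ι κ R) := by
  classical
  choose coeff hcoeff using fun v : Ideal.span (Set.range d) =>
    Ideal.mem_span_range_iff_exists_fun.1 v.2
  let E (v : κ → Ideal.span (Set.range d)) : Matrix ι κ R := .of fun i j => coeff (v j) i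
  have vecMul_E (v) : d ᵥ* E v = fun j => (v j : R) := by
    ext j
    simp only [Matrix.vecMul, dotProduct, E, Matrix.of_apply, ← hcoeff (v j), mul_comm]
  have hinj : Set.InjOn (fun Gv : Matrix ι κ R × (κ → Ideal.span (Set.range d)) => Gv.1 + E Gv.2)
      ↑(({G | d ᵥ* G = z} : Finset (Matrix ι κ R)) ×ˢ
        (univ : Finset (κ → Ideal.span (Set.range d)))) := by
    rintro ⟨G, v⟩ hG ⟨G', v'⟩ hG' h
    simp only [coe_product, coe_filter, mem_univ, true_and, Set.mem_prod, Set.mem_ofPred_eq,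
      coe_univ, Set.mem_univ, and_true] at hG hG'
    have hv : v = v' := by
      have := congrArg (d ᵥ* ·) h
      simpa [Matrix.vecMul_add, hG, hG', vecMul_E, funext_iff] using this
    subst hv
    simpa using h
  have := card_le_card_of_injOn (t := univ) _ (fun _ _ => mem_univ _) hinj
  simpa [card_product, Nat.card_eq_fintype_card] using this

lemma card_fiber_mul_pow_le (u u' : ι → R) (y y' : κ → R) :
    #{Gb : Matrix ι κ R × (κ → R) | (u ᵥ* Gb.1 + Gb.2, u' ᵥ* Gb.1 + Gb.2) = (y, y')} *
        Nat.card (diffIdeal u u') ^ Fintype.card κ ≤ Fintype.card (Matrix ι κ R) := by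
  have hG : #{Gb : Matrix ι κ R × (κ → R) | (u ᵥ* Gb.1 + Gb.2, u' ᵥ* Gb.1 + Gb.2) = (y, y')} ≤
      #{G : Matrix ι κ R | (u - u') ᵥ* G = y - y'} := by
    refine card_le_card_of_injOn Prod.fst (fun Gb hGb => ?_) fun Gb hGb Gb' hGb' h => ?_
    all_goals simp only [coe_filter, mem_univ, true_and, Set.mem_ofPred_eq, Prod.mk.injEq] at *
    · rw [← hGb.1, ← hGb.2, Matrix.sub_vecMul]; abel
    · refine Prod.ext h (add_left_cancel (hGb.1.trans (hGb'.1.symm.trans ?_)))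
      rw [h]
  exact (Nat.mul_le_mul_right _ hG).trans (card_vecMul_eq_mul_pow_le (u - u') (y - y'))

lemma card_hit_pair_mul_pow_le (u u' : ι → R) (T : Finset (κ → R)) :
    (#{Gb : Matrix ι κ R × (κ → R) | u ᵥ* Gb.1 + Gb.2 ∈ T ∧ u' ᵥ* Gb.1 + Gb.2 ∈ T} : ℝ) *
        Nat.card (diffIdeal u u') ^ Fintype.card κ ≤
      Fintype.card (Matrix ι κ R) *
        (collisionProb (fun y => Ideal.Quotient.mk (diffIdeal u u') ∘ y) T * #T ^ 2) := by
  classical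
  rw [← card_collisions]
  norm_cast
  rw [card_eq_sum_card_fiberwise (f := fun Gb => (u ᵥ* Gb.1 + Gb.2, u' ᵥ* Gb.1 + Gb.2))
    (t := {yy ∈ T ×ˢ T | Ideal.Quotient.mk (diffIdeal u u') ∘ yy.1 =
      Ideal.Quotient.mk (diffIdeal u u') ∘ yy.2}), sum_mul, mul_comm (Fintype.card _),
      ← smul_eq_mul (#_)]
  · refine sum_le_card_nsmul _ _ _ fun yy _ => ?_
    refine (Nat.mul_le_mul_right _ (card_le_card ?_)).trans (card_fiber_mul_pow_le u u' yy.1 yy.2)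
    exact filter_subset_filter _ (subset_univ _)
  · intro Gb hGb
    simp only [coe_filter, mem_univ, true_and, Set.mem_ofPred_eq, mem_product] at hGb ⊢
    refine ⟨hGb, funext fun j => Ideal.Quotient.eq.2 ?_⟩
    convert vecMul_mem_diffIdeal u u' Gb.1 j using 1
    simp [Matrix.sub_vecMul]

lemma card_hit_pair_le (u u' : ι → R) (T : Finset (κ → R)) :
    (#{Gb : Matrix ι κ R × (κ → R) | u ᵥ* Gb.1 + Gb.2 ∈ T ∧ u' ᵥ* Gb.1 + Gb.2 ∈ T} : ℝ) ≤
      Fintype.card (Matrix ι κ R) * #T ^ 2 / Fintype.card (κ → R) *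
        (collisionProb (fun y => Ideal.Quotient.mk (diffIdeal u u') ∘ y) T *
          Nat.card (R ⧸ diffIdeal u u') ^ Fintype.card κ) := by
  have hR : (Fintype.card (κ → R) : ℝ) =
      Nat.card (diffIdeal u u') ^ Fintype.card κ *
        Nat.card (R ⧸ diffIdeal u u') ^ Fintype.card κ := by
    rw [Fintype.card_fun, ← mul_pow, ← Nat.card_eq_fintype_card,
      Submodule.card_eq_card_quotient_mul_card (diffIdeal u u')]
    push_cast
    rfl
  have hI : (0 : ℝ) < Nat.card (diffIdeal u u') ^ Fintype.card κ := by
    exact_mod_cast pow_pos Nat.card_pos _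
  have hQ : (0 : ℝ) < Nat.card (R ⧸ diffIdeal u u') ^ Fintype.card κ := by
    exact_mod_cast pow_pos Nat.card_pos _
  rw [hR]
  refine ((le_div_iff₀ hI).2 (card_hit_pair_mul_pow_le u u' T)).trans_eq ?_
  field_simp

lemma card_hit (u : ι → R) (T : Finset (κ → R)) :
    #{Gb : Matrix ι κ R × (κ → R) | u ᵥ* Gb.1 + Gb.2 ∈ T} =
      Fintype.card (Matrix ι κ R) * #T := by
  rw [← card_univ, ← card_product]
  refine card_bij' (fun Gb _ => (Gb.1, u ᵥ* Gb.1 + Gb.2)) (fun Gy _ => (Gy.1, Gy.2 - u ᵥ* Gy.1))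
    ?_ ?_ ?_ ?_ <;> simp

end SecondMoment

lemma card_eq_zero_mul_sum_sq_le {Y : Type*} [Fintype Y] (f : Y → ℝ) [DecidablePred (f · = 0)] :
    #{y | f y = 0} * (∑ y, f y) ^ 2 ≤
      Fintype.card Y ^ 2 * ∑ y, f y ^ 2 - Fintype.card Y * (∑ y, f y) ^ 2 := by
  calc #{y | f y = 0} * (∑ y, f y) ^ 2
      = ∑ y with f y = 0, (Fintype.card Y * f y - ∑ y, f y) ^ 2 := by
        rw [← nsmul_eq_mul, ← sum_const]
        refine sum_congr rfl fun y hy => ?_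
        rw [(mem_filter.1 hy).2]
        ring
    _ ≤ ∑ y, (Fintype.card Y * f y - ∑ y, f y) ^ 2 :=
        sum_le_sum_of_subset_of_nonneg (filter_subset _ _) fun _ _ _ => sq_nonneg _
    _ = Fintype.card Y ^ 2 * ∑ y, f y ^ 2 - Fintype.card Y * (∑ y, f y) ^ 2 := by
        simp only [sub_sq, mul_pow, sum_add_distrib, sum_sub_distrib, sum_const, card_univ,
          nsmul_eq_mul, ← mul_sum, ← sum_mul, mul_assoc]
        ring

section MissProb

variable {R ι κ : Type*} [CommRing R] [Fintype R] [DecidableEq R] [Fintype ι] [DecidableEq ι]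
  [Fintype κ] [DecidableEq κ] {U : Finset (ι → R)} {T : Finset (κ → R)}

/-- The probability that no codeword `u ᵥ* G + b`, `u ∈ U`, lies in `T`, for independent uniform
`G` and `b`. -/
noncomputable def missProb (U : Finset (ι → R)) (T : Finset (κ → R)) : ℝ :=
  #{Gb : Matrix ι κ R × (κ → R) | ∀ u ∈ U, u ᵥ* Gb.1 + Gb.2 ∉ T} /
    Fintype.card (Matrix ι κ R × (κ → R))

lemma missProb_le_one (U : Finset (ι → R)) (T : Finset (κ → R)) : missProb U T ≤ 1 :=
  div_le_one_of_le₀ (by exact_mod_cast card_le_univ _) (Nat.cast_nonneg _)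

lemma sum_card_hits (U : Finset (ι → R)) (T : Finset (κ → R)) :
    ∑ Gb : Matrix ι κ R × (κ → R), #{u ∈ U | u ᵥ* Gb.1 + Gb.2 ∈ T} =
      #U * (Fintype.card (Matrix ι κ R) * #T) := by
  simp only [card_filter]
  rw [sum_comm]
  simp only [← card_filter, card_hit, sum_const, smul_eq_mul]

lemma sum_card_hits_sq (U : Finset (ι → R)) (T : Finset (κ → R)) :
    ∑ Gb : Matrix ι κ R × (κ → R), #{u ∈ U | u ᵥ* Gb.1 + Gb.2 ∈ T} ^ 2 =
      ∑ uu ∈ U ×ˢ U, #{Gb : Matrix ι κ R × (κ → R) |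
        uu.1 ᵥ* Gb.1 + Gb.2 ∈ T ∧ uu.2 ᵥ* Gb.1 + Gb.2 ∈ T} := by
  simp only [sq, ← card_product, ← filter_product]
  simp only [card_filter]
  rw [sum_comm]

open scoped Classical in
/-- The second moment bound for `missProb U T`: the pairs `u`, `u'` of elements of `U` whose
difference generates the proper ideal `I` contribute the `I`-th summand. -/
noncomputable def idealCollisionSum [Fintype (Ideal R)] (U : Finset (ι → R))
    (T : Finset (κ → R)) : ℝ :=
  ∑ I : Ideal R with I ≠ ⊤, collisionProb (fun u => Ideal.Quotient.mk I ∘ u) U *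
    (collisionProb (fun y => Ideal.Quotient.mk I ∘ y) T * Nat.card (R ⧸ I) ^ Fintype.card κ)

variable [Fintype (Ideal R)]

lemma sum_card_hits_sq_le (U : Finset (ι → R)) (T : Finset (κ → R)) :
    ∑ Gb : Matrix ι κ R × (κ → R), (#{u ∈ U | u ᵥ* Gb.1 + Gb.2 ∈ T} : ℝ) ^ 2 ≤
      Fintype.card (Matrix ι κ R) * #T ^ 2 / Fintype.card (κ → R) *
        (#U ^ 2 * (1 + idealCollisionSum U T)) := by
  let w (I : Ideal R) : ℝ := collisionProb (fun y : κ → R => Ideal.Quotient.mk I ∘ y) T *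
    Nat.card (R ⧸ I) ^ Fintype.card κ
  have hw (I) : 0 ≤ w I := mul_nonneg (collisionProb_nonneg _ _) (by positivity)
  have hw_top : w ⊤ ≤ 1 := by simpa [w] using collisionProb_le_one _ T
  calc ∑ Gb : Matrix ι κ R × (κ → R), (#{u ∈ U | u ᵥ* Gb.1 + Gb.2 ∈ T} : ℝ) ^ 2
      = ∑ uu ∈ U ×ˢ U, (#{Gb : Matrix ι κ R × (κ → R) |
          uu.1 ᵥ* Gb.1 + Gb.2 ∈ T ∧ uu.2 ᵥ* Gb.1 + Gb.2 ∈ T} : ℝ) := by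
        exact_mod_cast sum_card_hits_sq U T
    _ ≤ ∑ uu ∈ U ×ˢ U, Fintype.card (Matrix ι κ R) * #T ^ 2 / Fintype.card (κ → R) *
          w (diffIdeal uu.1 uu.2) :=
        sum_le_sum fun uu _ => card_hit_pair_le uu.1 uu.2 T
    _ ≤ _ := by
        rw [← mul_sum]
        gcongr
        exact (sum_diffIdeal_le U hw).trans (by gcongr; rfl)

lemma missProb_le_idealCollisionSum (hU : U.Nonempty) (hT : T.Nonempty) :
    missProb U T ≤ idealCollisionSum U T := by
  set M : ℝ := (Fintype.card (Matrix ι κ R) : ℝ)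
  set V : ℝ := (Fintype.card (κ → R) : ℝ)
  have hM : 0 < M := Nat.cast_pos.2 Fintype.card_pos
  have hV : 0 < V := Nat.cast_pos.2 Fintype.card_pos
  have hN : (Fintype.card (Matrix ι κ R × (κ → R)) : ℝ) = M * V := by
    rw [Fintype.card_prod, Nat.cast_mul]
  let hits (Gb : Matrix ι κ R × (κ → R)) : ℝ := #{u ∈ U | u ᵥ* Gb.1 + Gb.2 ∈ T}
  have hmiss : missProb U T = #{Gb | hits Gb = 0} / (M * V) := by
    rw [missProb, hN]
    congr! 3
    simp [hits, filter_eq_empty_iff]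
  have hsum : ∑ Gb, hits Gb = #U * (M * #T) := by
    simp only [hits, M]
    exact_mod_cast sum_card_hits U T
  have hpos : (0 : ℝ) < (#U * (M * #T)) ^ 2 := by
    have := hU.card_pos
    have := hT.card_pos
    positivity
  rw [hmiss, div_le_iff₀ (by positivity)]
  refine le_of_mul_le_mul_right ?_ hpos
  calc #{Gb | hits Gb = 0} * (#U * (M * #T)) ^ 2
      ≤ (M * V) ^ 2 * ∑ Gb, hits Gb ^ 2 - M * V * (#U * (M * #T)) ^ 2 := by
        simpa only [hsum, hN] using card_eq_zero_mul_sum_sq_le hits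
    _ ≤ (M * V) ^ 2 * (M * #T ^ 2 / V * (#U ^ 2 * (1 + idealCollisionSum U T))) -
          M * V * (#U * (M * #T)) ^ 2 := by
        gcongr
        exact sum_card_hits_sq_le U T
    _ = idealCollisionSum U T * (M * V) * (#U * (M * #T)) ^ 2 := by
        field_simp
        ring

end MissProb

section ResidueRep

variable {m : ℕ} {ι κ : Type*}

lemma ringChar_quotient_dvd (I : Ideal (ZMod m)) : ringChar (ZMod m ⧸ I) ∣ m :=
  ringChar.dvd (by rw [← map_natCast (Ideal.Quotient.mk I), ZMod.natCast_self, map_zero])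

lemma ringChar_quotient_ne_one {I : Ideal (ZMod m)} (hI : I ≠ ⊤) : ringChar (ZMod m ⧸ I) ≠ 1 :=
  have := Ideal.Quotient.nontrivial_iff.2 hI
  CharP.ringChar_ne_one

variable [NeZero m]

/-- The residue of `a` modulo `d`, as an element of `ZMod m`. For `d = p ^ s` this is the coset
representative `[a]_s`. -/
def residueRep (d : ℕ) (a : ZMod m) : ZMod m :=
  ((a.val % d : ℕ) : ZMod m)

lemma mk_eq_natCast_val (I : Ideal (ZMod m)) (a : ZMod m) :
    Ideal.Quotient.mk I a = (a.val : ZMod m ⧸ I) := by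
  rw [← map_natCast (Ideal.Quotient.mk I), ZMod.natCast_zmod_val]

lemma residueRep_ringChar_eq {I : Ideal (ZMod m)} {a b : ZMod m}
    (h : Ideal.Quotient.mk I a = Ideal.Quotient.mk I b) :
    residueRep (ringChar (ZMod m ⧸ I)) a = residueRep (ringChar (ZMod m ⧸ I)) b := by
  rw [mk_eq_natCast_val, mk_eq_natCast_val,
    CharP.natCast_eq_natCast _ (ringChar (ZMod m ⧸ I))] at h
  rw [residueRep, residueRep, h]

lemma card_quotient_le_ringChar (I : Ideal (ZMod m)) :
    Nat.card (ZMod m ⧸ I) ≤ ringChar (ZMod m ⧸ I) := by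
  have : NeZero (ringChar (ZMod m ⧸ I)) :=
    ⟨fun h => NeZero.ne m (Nat.eq_zero_of_zero_dvd (h ▸ ringChar_quotient_dvd I))⟩
  have hsurj : Function.Surjective
      (ZMod.castHom (dvd_refl (ringChar (ZMod m ⧸ I))) (ZMod m ⧸ I)) := fun x => by
    obtain ⟨a, rfl⟩ := Ideal.Quotient.mk_surjective x
    exact ⟨a.val, by rw [map_natCast, mk_eq_natCast_val]⟩
  simpa using Nat.card_le_card_of_surjective _ hsurj

lemma collisionProb_mk_le (I : Ideal (ZMod m)) (S : Finset (ι → ZMod m)) :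
    collisionProb (fun u => Ideal.Quotient.mk I ∘ u) S ≤
      collisionProb (fun u => residueRep (ringChar (ZMod m ⧸ I)) ∘ u) S :=
  collisionProb_mono (fun _ _ h => funext fun i => residueRep_ringChar_eq (congrFun h i)) S

lemma idealCollisionSum_le [Fintype κ] [Fintype (Ideal (ZMod m))] {U : Finset (ι → ZMod m)}
    {T : Finset (κ → ZMod m)} {B : ℝ} (hB₀ : 0 ≤ B)
    (hB : ∀ d, d ∣ m → d ≠ 1 → collisionProb (fun u => residueRep d ∘ u) U *
      (collisionProb (fun y => residueRep d ∘ y) T * (d : ℝ) ^ Fintype.card κ) ≤ B) :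
    idealCollisionSum U T ≤ Fintype.card (Ideal (ZMod m)) * B := by
  classical
  calc idealCollisionSum U T ≤ ∑ I : Ideal (ZMod m) with I ≠ ⊤, B := by
        rw [idealCollisionSum]
        refine (sum_congr (by congr!) fun _ _ => rfl).trans_le (sum_le_sum fun I hI => ?_)
        refine le_trans ?_ (hB _ (ringChar_quotient_dvd I)
          (ringChar_quotient_ne_one (mem_filter.1 hI).2))
        have hUI := collisionProb_mk_le I U
        have hTI := collisionProb_mk_le I T
        have hcard : (Nat.card (ZMod m ⧸ I) : ℝ) ≤ ringChar (ZMod m ⧸ I) := by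
          exact_mod_cast card_quotient_le_ringChar I
        have := collisionProb_nonneg (fun y => Ideal.Quotient.mk I ∘ y) T
        have := collisionProb_nonneg (fun u => residueRep (ringChar (ZMod m ⧸ I)) ∘ u) U
        have := collisionProb_nonneg (fun u => residueRep (ringChar (ZMod m ⧸ I)) ∘ u) T
        gcongr
    _ ≤ Fintype.card (Ideal (ZMod m)) * B := by
        rw [sum_const, nsmul_eq_mul]
        gcongr
        exact card_le_univ _

end ResidueRep

section TypicalSlice

variable {α β γ : Type*} [Fintype α] [DecidableEq α] [Fintype β] [DecidableEq β] [Fintype γ]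
  [DecidableEq γ] {P : α × β → ℝ} {ε : ℝ} {n : ℕ} {x : Fin n → α}

open Classical in
/-- The sequences that are jointly `ε`-typical with `x`. -/
noncomputable def typicalSlice (P : α × β → ℝ) (ε : ℝ) (x : Fin n → α) : Finset (Fin n → β) :=
  {y | JointlyTypical P ε x y}

lemma mem_typicalSlice {y : Fin n → β} : y ∈ typicalSlice P ε x ↔ JointlyTypical P ε x y := by
  simp [typicalSlice]

lemma map_typicalSlice (P : α × β → ℝ) (ε : ℝ) (x : Fin n → α) :
    (typicalSlice P ε x).map ⟨fun y i => (x i, y i), fun _ _ h => funext fun i =>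
      congrArg Prod.snd (congrFun h i)⟩ = typicalFiber P Prod.fst ε x := by
  ext v
  simp only [Finset.mem_map, mem_typicalSlice, JointlyTypical, typicalFiber, mem_filter,
    mem_typicalSet]
  constructor
  · rintro ⟨y, hy, rfl⟩
    exact ⟨hy, rfl⟩
  · rintro ⟨hv, rfl⟩
    exact ⟨Prod.snd ∘ v, hv, rfl⟩

lemma typicalSlice_nonempty (hx : 1 / 2 ≤ condTypicalProb P Prod.fst ε x) :
    (typicalSlice P ε x).Nonempty := by
  rw [← map_nonempty, map_typicalSlice]
  exact typicalFiber_nonempty hx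

lemma collisionProb_typicalSlice_le (hP : ∀ ω, 0 ≤ P ω) (hε : 0 ≤ ε)
    (hx : 1 / 2 ≤ condTypicalProb P Prod.fst ε x) (V : β → γ) :
    collisionProb (fun y => V ∘ y) (typicalSlice P ε x) ≤
      2 * 2 ^ (-(n * (condEntropy P (fun ω => V ω.2) Prod.fst -
        2 * (ε * logSpread P Prod.fst)))) := by
  refine le_trans (le_of_eq ?_) (collisionProb_typicalFiber_le hP hε hx fun ω => V ω.2)
  rw [← map_typicalSlice, collisionProb_map]
  rfl

end TypicalSlice

section Code

variable {m : ℕ} [NeZero m] {Q X : Type*} [Fintype Q] [DecidableEq Q]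

lemma rate_code_le {PUQ : ZMod m × Q → ℝ} {ε : ℝ} {k : Q → ℕ} {n : ℕ}
    (G : Matrix (Σ q, Fin (k q)) (Fin n) (ZMod m)) (b : Fin n → ZMod m)
    (h : (indexSet PUQ ε k).Nonempty) :
    rate n (code PUQ ε k G b) ≤ rate n (indexSet PUQ ε k) := by
  have himage : code PUQ ε k G b = (fun u => u ᵥ* G + b) '' indexSet PUQ ε k := by
    simp only [code, Set.image, eq_comm]
  have hpos : 0 < (code PUQ ε k G b).ncard :=
    (Set.ncard_pos (Set.toFinite _)).2 (himage ▸ h.image _)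
  refine div_le_div_of_nonneg_right ?_ n.cast_nonneg
  refine Real.logb_le_logb_of_le one_lt_two (Nat.cast_pos.2 hpos) (Nat.cast_le.2 ?_)
  exact himage ▸ Set.ncard_image_le (Set.toFinite _)

variable [Fintype X] [DecidableEq X]

lemma sum_indicator_ensembleLaw (PUQ : ZMod m × Q → ℝ) (PXX : X × ZMod m → ℝ) (ε : ℝ)
    (k : Q → ℕ) {n : ℕ} (x : Fin n → X) (PX : X → ℝ) :
    ∑ Gb : Matrix (Σ q, Fin (k q)) (Fin n) (ZMod m) × (Fin n → ZMod m),
      Set.indicator {ω | ∃ y ∈ code PUQ ε k ω.2.1 ω.2.2, JointlyTypical PXX ε ω.1 y}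
        (ensembleLaw PX k n) (x, Gb) =
      (∏ i, PX (x i)) * (1 - missProb (indexFinset PUQ ε k) (typicalSlice PXX ε x)) := by
  classical
  set N : ℝ := (Fintype.card (Matrix (Σ q, Fin (k q)) (Fin n) (ZMod m) × (Fin n → ZMod m)) : ℝ)
    with hN
  have hN₀ : N ≠ 0 := Nat.cast_ne_zero.2 Fintype.card_ne_zero
  let Miss (Gb : Matrix (Σ q, Fin (k q)) (Fin n) (ZMod m) × (Fin n → ZMod m)) : Prop :=
    ∀ u ∈ indexFinset PUQ ε k, u ᵥ* Gb.1 + Gb.2 ∉ typicalSlice PXX ε x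
  have hhit (Gb) : (∃ y ∈ code PUQ ε k Gb.1 Gb.2, JointlyTypical PXX ε x y) ↔ ¬ Miss Gb := by
    simp [Miss, code, mem_typicalSlice, ← coe_indexFinset, and_comm]
  have hcount : (#{Gb | Miss Gb} : ℝ) + #{Gb | ¬ Miss Gb} = N := by
    rw [hN, ← card_univ, ← card_filter_add_card_filter_not (s := univ) Miss, Nat.cast_add]
  have hmiss : missProb (indexFinset PUQ ε k) (typicalSlice PXX ε x) = #{Gb | Miss Gb} / N := by
    rw [missProb]
  simp only [Set.indicator_apply, Set.mem_ofPred_eq, hhit]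
  have hlaw (Gb : Matrix (Σ q, Fin (k q)) (Fin n) (ZMod m) × (Fin n → ZMod m)) :
      ensembleLaw PX k n (x, Gb) = (∏ i, PX (x i)) / N := by
    rw [ensembleLaw, hN, Fintype.card_prod, Nat.cast_mul]
    field_simp
  simp only [hlaw]
  rw [← sum_filter, sum_const, nsmul_eq_mul, hmiss, eq_sub_of_add_eq' hcount]
  field_simp

lemma coverProb_eq_one_sub_sum (PUQ : ZMod m × Q → ℝ) {PXX : X × ZMod m → ℝ}
    (hPXX : PXX ∈ stdSimplex ℝ (X × ZMod m)) (ε : ℝ) (k : Q → ℕ) (n : ℕ) :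
    coverProb PUQ PXX ε k n = 1 - ∑ x : Fin n → X, (∏ i, law PXX Prod.fst (x i)) *
      missProb (indexFinset PUQ ε k) (typicalSlice PXX ε x) := by
  have hone : ∑ x : Fin n → X, ∏ i, law PXX Prod.fst (x i) = 1 := by
    rw [← Fintype.sum_pow, (law_mem_stdSimplex hPXX Prod.fst).2, one_pow]
  rw [coverProb, Fintype.sum_prod_type]
  simp only [sum_indicator_ensembleLaw, mul_sub, mul_one, sum_sub_distrib, hone]

end Code

section CoveringExponent

variable {m : ℕ} [NeZero m] {Q X : Type*} [Fintype Q] [DecidableEq Q] [Fintype X] [DecidableEq X]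
  {PUQ : ZMod m × Q → ℝ} {PXX : X × ZMod m → ℝ} {c ε : ℝ}

/-- The expression of the covering bound belonging to the divisor `d` of `m`; it is
`coveringBound` at `s` when `d = p ^ s`. -/
noncomputable def divisorBound (PUQ : ZMod m × Q → ℝ) (PXX : X × ZMod m → ℝ) (e : ℝ) (d : ℕ) : ℝ :=
  condEntropy PUQ Prod.fst Prod.snd / condEntropy PUQ (fun ω => residueRep d ω.1) Prod.snd *
    (Real.logb 2 d - condEntropy PXX (fun ω => residueRep d ω.2) Prod.fst + e)

/-- The factor `C` for which `η ε = C * ε` absorbs the typicality errors of the size of the index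
set and of the two collision probabilities, and leaves an exponent of `-ε`. -/
noncomputable def coveringSlack (c : ℝ) (PUQ : ZMod m × Q → ℝ) (PXX : X × ZMod m → ℝ) : ℝ :=
  (c * condLogSpread PUQ + 1) + (2 * c * condLogSpread PUQ + 1) +
    2 * logSpread PXX Prod.fst + 1

lemma lt_mul_add_of_div_mul_lt {H h L c e : ℝ} (hh : 0 < h) (hH : h ≤ H) (he : 0 ≤ e)
    (hlt : H / h * L < c * H + e) : L < c * h + e := by
  have hH₀ : 0 < H := hh.trans_le hH
  refine lt_of_mul_lt_mul_left ?_ hH₀.le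
  calc H * L = H / h * L * h := by field_simp
    _ < (c * H + e) * h := by gcongr
    _ ≤ H * (c * h + e) := by nlinarith

lemma rate_indexSet_le {n : ℕ} (hn : 0 < n) {k : Q → ℕ} {E : ℝ}
    (hne : (indexFinset PUQ ε k).Nonempty) (h : (#(indexFinset PUQ ε k) : ℝ) ≤ 2 ^ (n * E)) :
    rate n (indexSet PUQ ε k) ≤ E := by
  have hn' : (0 : ℝ) < n := Nat.cast_pos.2 hn
  rw [rate, ← coe_indexFinset, Set.ncard_coe_finset, div_le_iff₀ hn', mul_comm,
    Real.logb_le_iff_le_rpow one_lt_two (Nat.cast_pos.2 hne.card_pos)]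
  exact h

lemma covering_exponent_le (hPUQ : ∀ ω, 0 ≤ PUQ ω) (hQ : ∀ q, 0 < law PUQ Prod.snd q) (hc : 0 < c)
    (hε : 0 < ε) {d : ℕ} (hd : 0 < condEntropy PUQ (fun ω => residueRep d ω.1) Prod.snd)
    (hbound : divisorBound PUQ PXX (coveringSlack c PUQ PXX * ε) d <
      c * condEntropy PUQ Prod.fst Prod.snd + ε * (c * condLogSpread PUQ + 1)) :
    Real.logb 2 d -
        (c * condEntropy PUQ (fun ω => residueRep d ω.1) Prod.snd -
          ε * (2 * c * condLogSpread PUQ + 1)) -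
        (condEntropy PXX (fun ω => residueRep d ω.2) Prod.fst -
          2 * (ε * logSpread PXX Prod.fst)) ≤ -ε := by
  have hS := condLogSpread_nonneg hQ
  have := lt_mul_add_of_div_mul_lt hd (condEntropy_comp_fst_le hPUQ hQ _) (by positivity) hbound
  rw [coveringSlack] at this
  linarith

lemma mul_mul_pow_le_two_mul_rpow {a b gU gX : ℝ} {d n : ℕ} (hd : 0 < d) (hb : 0 ≤ b)
    (haU : a ≤ 2 ^ (-(n * gU))) (hbX : b ≤ 2 * 2 ^ (-(n * gX)))
    (hexp : Real.logb 2 d - gU - gX ≤ -ε) : a * (b * (d : ℝ) ^ n) ≤ 2 * 2 ^ (-(n * ε)) := by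
  have hpow : (d : ℝ) ^ n = 2 ^ (n * Real.logb 2 d) := by
    rw [mul_comm, Real.rpow_mul zero_le_two,
      Real.rpow_logb two_pos (by norm_num) (Nat.cast_pos.2 hd), Real.rpow_natCast]
  calc a * (b * (d : ℝ) ^ n)
      ≤ 2 ^ (-(n * gU)) * (2 * 2 ^ (-(n * gX)) * 2 ^ (n * Real.logb 2 d)) := by
        rw [hpow]
        gcongr
    _ = 2 * 2 ^ (n * (Real.logb 2 d - gU - gX)) := by
        rw [show n * (Real.logb 2 d - gU - gX) =
          -(n * gU) + (-(n * gX) + n * Real.logb 2 d) by ring, Real.rpow_add two_pos,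
          Real.rpow_add two_pos]
        ring
    _ ≤ 2 * 2 ^ (-(n * ε)) := by
        rw [← mul_neg]
        gcongr
        exact one_le_two

lemma eventually_missProb_le (hPUQ : ∀ ω, 0 ≤ PUQ ω) (hQ : ∀ q, 0 < law PUQ Prod.snd q)
    (hU : ∀ d, d ∣ m → d ≠ 1 → 0 < condEntropy PUQ (fun ω => residueRep d ω.1) Prod.snd)
    (hPXX : ∀ ω, 0 ≤ PXX ω) (hc : 0 < c) (hε : 0 < ε) [Fintype (Ideal (ZMod m))] :
    ∀ᶠ n : ℕ in atTop, ∀ k : Q → ℕ, (∀ q, |(k q : ℝ) - law PUQ Prod.snd q * (c * n)| < 1) →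
      (∀ d, d ∣ m → d ≠ 1 →
        divisorBound PUQ PXX (coveringSlack c PUQ PXX * ε) d < rate n (indexSet PUQ ε k)) →
      ∀ x : Fin n → X, 1 / 2 ≤ condTypicalProb PXX Prod.fst ε x →
        missProb (indexFinset PUQ ε k) (typicalSlice PXX ε x) ≤
          Fintype.card (Ideal (ZMod m)) * (2 * 2 ^ (-(n * ε))) := by
  have hcoll : ∀ᶠ n : ℕ in atTop, ∀ d ∈ m.divisors, ∀ k : Q → ℕ,
      (∀ q, |(k q : ℝ) - law PUQ Prod.snd q * (c * n)| < 1) →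
      collisionProb (fun u => residueRep d ∘ u) (indexFinset PUQ ε k) ≤
        2 ^ (-(n * (c * condEntropy PUQ (fun ω => residueRep d ω.1) Prod.snd -
          ε * (2 * c * condLogSpread PUQ + 1)))) :=
    (eventually_all_finset _).2 fun d _ =>
      eventually_collisionProb_indexFinset_le hPUQ hQ hc hε (residueRep d)
  filter_upwards [hcoll, eventually_indexFinset_nonempty hPUQ hQ hc hε,
    eventually_card_indexFinset_le hPUQ hQ c hε, eventually_gt_atTop 0]
    with n hcoll hne hcard hn k hk hrate x hx
  refine (missProb_le_idealCollisionSum (hne k hk) (typicalSlice_nonempty hx)).trans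
    (idealCollisionSum_le (by positivity) fun d hdm hd => ?_)
  have hexp := covering_exponent_le hPUQ hQ hc hε (hU d hdm hd)
    ((hrate d hdm hd).trans_le (rate_indexSet_le hn (hne k hk) (hcard k hk)))
  rw [Fintype.card_fin]
  exact mul_mul_pow_le_two_mul_rpow (Nat.pos_of_dvd_of_pos hdm (NeZero.pos m))
    (collisionProb_nonneg _ _) (hcoll d (Nat.mem_divisors.2 ⟨hdm, NeZero.ne m⟩) k hk)
    (collisionProb_typicalSlice_le hPXX hε.le hx (residueRep d)) hexp

lemma coverProb_ge (hPXX : PXX ∈ stdSimplex ℝ (X × ZMod m)) {n : ℕ} {k : Q → ℕ} {B : ℝ}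
    (hB₀ : 0 ≤ B) (hB : ∀ x : Fin n → X, 1 / 2 ≤ condTypicalProb PXX Prod.fst ε x →
      missProb (indexFinset PUQ ε k) (typicalSlice PXX ε x) ≤ B) :
    1 - (B + ∑ x : Fin n → X with condTypicalProb PXX Prod.fst ε x < 1 / 2,
      ∏ i, law PXX Prod.fst (x i)) ≤ coverProb PUQ PXX ε k n := by
  have hlaw := law_mem_stdSimplex hPXX Prod.fst
  have hprod (x : Fin n → X) : 0 ≤ ∏ i, law PXX Prod.fst (x i) := prod_nonneg fun i _ => hlaw.1 _
  rw [coverProb_eq_one_sub_sum PUQ hPXX]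
  gcongr
  calc ∑ x : Fin n → X, (∏ i, law PXX Prod.fst (x i)) *
        missProb (indexFinset PUQ ε k) (typicalSlice PXX ε x)
      ≤ ∑ x : Fin n → X, ((∏ i, law PXX Prod.fst (x i)) * B +
          if condTypicalProb PXX Prod.fst ε x < 1 / 2 then ∏ i, law PXX Prod.fst (x i) else 0) := by
        refine sum_le_sum fun x _ => ?_
        split_ifs with hx
        · nlinarith [hprod x, missProb_le_one (indexFinset PUQ ε k) (typicalSlice PXX ε x),
            mul_nonneg (hprod x) hB₀]
        · rw [add_zero]
          exact mul_le_mul_of_nonneg_left (hB x (not_lt.1 hx)) (hprod x)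
    _ = _ := by
        rw [sum_add_distrib, ← sum_mul, ← Fintype.sum_pow, hlaw.2, one_pow, one_mul, sum_filter]

lemma tendsto_const_mul_two_rpow_neg_mul (C : ℝ) (hε : 0 < ε) :
    Tendsto (fun n : ℕ => C * (2 * (2 : ℝ) ^ (-(n * ε)))) atTop (𝓝 0) := by
  have h : Tendsto (fun n : ℕ => ((2 : ℝ) ^ (-ε)) ^ n) atTop (𝓝 0) :=
    tendsto_pow_atTop_nhds_zero_of_lt_one (by positivity)
      (Real.rpow_lt_one_of_one_lt_of_neg one_lt_two (neg_neg_of_pos hε))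
  have hpow (n : ℕ) : (2 : ℝ) ^ (-(n * ε)) = ((2 : ℝ) ^ (-ε)) ^ n := by
    rw [← Real.rpow_natCast, ← Real.rpow_mul zero_le_two, neg_mul, mul_comm]
  simpa only [hpow, mul_zero] using (h.const_mul 2).const_mul C

lemma eventually_coverProb_gt (hPUQ : ∀ ω, 0 ≤ PUQ ω) (hQ : ∀ q, 0 < law PUQ Prod.snd q)
    (hU : ∀ d, d ∣ m → d ≠ 1 → 0 < condEntropy PUQ (fun ω => residueRep d ω.1) Prod.snd)
    (hPXX : PXX ∈ stdSimplex ℝ (X × ZMod m)) (hc : 0 < c) (hε : 0 < ε) {δ : ℝ} (hδ : 0 < δ) :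
    ∀ᶠ n : ℕ in atTop, ∀ k : Q → ℕ, (∀ q, |(k q : ℝ) - law PUQ Prod.snd q * (c * n)| < 1) →
      (∀ d, d ∣ m → d ≠ 1 →
        divisorBound PUQ PXX (coveringSlack c PUQ PXX * ε) d < rate n (indexSet PUQ ε k)) →
      1 - δ < coverProb PUQ PXX ε k n := by
  have := Fintype.ofFinite (Ideal (ZMod m))
  filter_upwards [eventually_missProb_le hPUQ hQ hU hPXX.1 hc hε,
    (tendsto_const_mul_two_rpow_neg_mul (Fintype.card (Ideal (ZMod m))) hε).eventually
      (gt_mem_nhds (half_pos hδ)),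
    eventually_sum_prod_law_condTypicalProb_lt_half_lt hPXX Prod.fst hε (half_pos hδ)]
    with n hmiss hsmall hatypical k hk hrate
  have := coverProb_ge (PUQ := PUQ) hPXX (by positivity) (hmiss k hk hrate)
  linarith

end CoveringExponent

section PrimePower

lemma forall_dvd_prime_pow_iff {p r : ℕ} (hp : p.Prime) {φ : ℕ → Prop} :
    (∀ d, d ∣ p ^ r → d ≠ 1 → φ d) ↔ ∀ s, 1 ≤ s → s ≤ r → φ (p ^ s) := by
  constructor
  · exact fun h s hs hsr => h _ (pow_dvd_pow p hsr) (Nat.one_lt_pow (by lia) hp.one_lt).ne'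
  · intro h d hd hd₁
    obtain ⟨s, hsr, rfl⟩ := (Nat.dvd_prime_pow hp).1 hd
    exact h s (Nat.one_le_iff_ne_zero.2 fun hs => hd₁ (by rw [hs, pow_zero])) hsr

lemma divisorBound_prime_pow {p r : ℕ} [NeZero (p ^ r)] {Q X : Type*} [Fintype Q] [DecidableEq Q]
    [Fintype X] [DecidableEq X] (PUQ : ZMod (p ^ r) × Q → ℝ) (PXX : X × ZMod (p ^ r) → ℝ)
    (e : ℝ) (s : ℕ) : divisorBound PUQ PXX e (p ^ s) = coveringBound PUQ PXX e s := by
  rw [divisorBound, Nat.cast_pow]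
  rfl

end PrimePower

end QGC

open QGC in
theorem mainTheorem6_general (m : ℕ) [NeZero m]
    {Q X : Type*} [Fintype Q] [DecidableEq Q] [Fintype X] [DecidableEq X]
    (PUQ : ZMod m × Q → ℝ) (hPUQ : PUQ ∈ stdSimplex ℝ (ZMod m × Q))
    (hQ : ∀ q, 0 < law PUQ Prod.snd q)
    (hU : ∀ d, d ∣ m → d ≠ 1 → 0 < condEntropy PUQ (fun ω => residueRep d ω.1) Prod.snd)
    (PXX : X × ZMod m → ℝ) (hPXX : PXX ∈ stdSimplex ℝ (X × ZMod m)) (c : ℝ) (hc : 0 < c) :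
    ∃ η : ℝ → ℝ, Filter.Tendsto η (nhdsWithin 0 (Set.Ioi 0)) (nhds 0) ∧
      ∀ ε : ℝ, 0 < ε → ∀ δ : ℝ, 0 < δ → ∃ N : ℕ, ∀ n : ℕ, N < n →
        ∀ k : Q → ℕ, (∀ q, |(k q : ℝ) - law PUQ Prod.snd q * (c * n)| < 1) →
          ((∀ d, d ∣ m → d ≠ 1 →
              divisorBound PUQ PXX (η ε) d < rate n (indexSet PUQ ε k)) →
            1 - δ < coverProb PUQ PXX ε k n) ∧
          (∀ (G : Matrix (Σ q, Fin (k q)) (Fin n) (ZMod m)) (b : Fin n → ZMod m),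
            (∀ d, d ∣ m → d ≠ 1 →
              divisorBound PUQ PXX (η ε) d < rate n (code PUQ ε k G b)) →
            1 - δ < coverProb PUQ PXX ε k n) := by
  refine ⟨fun ε => coveringSlack c PUQ PXX * ε, ?_, fun ε hε δ hδ => ?_⟩
  · exact ((continuous_const_mul _).tendsto' 0 0 (mul_zero _)).mono_left nhdsWithin_le_nhds
  · obtain ⟨N, hN⟩ := Filter.eventually_atTop.1
      ((eventually_coverProb_gt hPUQ.1 hQ hU hPXX hc hε hδ).and
        (eventually_indexFinset_nonempty hPUQ.1 hQ hc hε))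
    refine ⟨N, fun n hn k hk => ?_⟩
    obtain ⟨hcover, hne⟩ := hN n hn.le
    have hne : (indexSet PUQ ε k).Nonempty := coe_indexFinset PUQ ε k ▸ (hne k hk).to_set
    exact ⟨hcover k hk, fun G b hG => hcover k hk fun d hdm hd =>
      (hG d hdm hd).trans_le (rate_code_le G b hne)⟩

theorem mainTheorem6 (p r : ℕ) [Fact p.Prime] (hr : 1 ≤ r)
    {Q X : Type*} [Fintype Q] [DecidableEq Q] [Fintype X] [DecidableEq X]
    (PUQ : ZMod (p ^ r) × Q → ℝ) (hPUQ : PUQ ∈ stdSimplex ℝ (ZMod (p ^ r) × Q))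
    (hQ : ∀ q, 0 < QGC.law PUQ Prod.snd q)
    (hU : ∀ s, 1 ≤ s → s ≤ r →
      0 < QGC.condEntropy PUQ (fun ω => QGC.cosetRep p r s ω.1) Prod.snd)
    (PXX : X × ZMod (p ^ r) → ℝ) (hPXX : PXX ∈ stdSimplex ℝ (X × ZMod (p ^ r)))
    (c : ℝ) (hc : 0 < c) :
    ∃ η : ℝ → ℝ, Filter.Tendsto η (nhdsWithin 0 (Set.Ioi 0)) (nhds 0) ∧
      ∀ ε : ℝ, 0 < ε → ∀ δ : ℝ, 0 < δ → ∃ N : ℕ, ∀ n : ℕ, N < n →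
        ∀ k : Q → ℕ, (∀ q, |(k q : ℝ) - QGC.law PUQ Prod.snd q * (c * n)| < 1) →
          ((∀ s, 1 ≤ s → s ≤ r →
              QGC.coveringBound PUQ PXX (η ε) s < QGC.rate n (QGC.indexSet PUQ ε k)) →
            1 - δ < QGC.coverProb PUQ PXX ε k n) ∧
          (∀ (G : Matrix (Σ q, Fin (k q)) (Fin n) (ZMod (p ^ r))) (b : Fin n → ZMod (p ^ r)),
            (∀ s, 1 ≤ s → s ≤ r →
              QGC.coveringBound PUQ PXX (η ε) s < QGC.rate n (QGC.code PUQ ε k G b)) →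
            1 - δ < QGC.coverProb PUQ PXX ε k n) := by
  have hp : p.Prime := Fact.out
  simpa only [QGC.forall_dvd_prime_pow_iff hp, QGC.divisorBound_prime_pow] using
    mainTheorem6_general (p ^ r) PUQ hPUQ hQ ((QGC.forall_dvd_prime_pow_iff hp).2 hU) PXX hPXX c hc
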